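/- Let $m,n\ge 1$ be integers and let $K_{m,n}$ be the metric complete bipartite graph with vertices $v_1,\dots,v_m,w_1,\dots,w_n$ and one edge of length $1$ between $v_i$ and $w_j$ for all $i,j$. A divisor on $K_{m,n}$ is a finite formal $\mathbb{Z}$-linear combination of points of $K_{m,n}$ (vertices or points in the interior of edges); its degree is the sum of its coefficients, and it is effective if all its coefficients are nonnegative. Two divisors are linearly equivalent if their difference is of the form $\sum_p \operatorname{ord}_p(f)\,(p)$, where $f$ is a continuous real-valued function on $K_{m,n}$ that is piecewise linear with integer slopes (and finitely many pieces) on every edge, and $\operatorname{ord}_p(f)$ is the sum of the outgoing slopes of $f$ at $p$. The rank of a divisor $D$ is the largest integer $k\ge -1$ such that, for every effective divisor $E$ of degree $k$, the divisor $D-E$ is linearly equivalent to an effective divisor (so the rank is $-1$ if $D$ is not linearly equivalent to an effective divisor). Then for all integers $a,b$ with $0\le a\le m-1$ and $0\le b\le n-1$, the divisor $$\sum_{i=1}^m b\,(v_i)+\sum_{j=1}^n a\,(w_j)$$ on $K_{m,n}$ has degree $an+bm$ and rank $(a+1)(b+1)-1$. -/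

import Mathlib

/-- A compact metric graph presented by a finite model: finitely many vertices and edges, the edge
`e` being a segment of length `len e > 0` glued to the vertices `src e` and `tgt e`. The orientation
only serves to parametrise the edge. -/
structure MetricGraph where
  V : Type
  E : Type
  [fintypeV : Fintype V]
  [fintypeE : Fintype E]
  src : E → V
  tgt : E → V
  len : E → ℝ
  len_pos : ∀ e, 0 < len e

attribute [instance] MetricGraph.fintypeV MetricGraph.fintypeE

namespace MetricGraph

/-- The points of the metric graph: the vertices, and for every edge `e` the points of its interior,
given by their distance `t ∈ (0, len e)` from the source along `e`. -/
inductive Point (Γ : MetricGraph) : Type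
  | vertex (v : Γ.V) : Point Γ
  | interior (e : Γ.E) (t : ℝ) (h₀ : 0 < t) (h₁ : t < Γ.len e) : Point Γ

variable (Γ : MetricGraph)

/-- The parametrisation of the closed edge `e` by `[0, len e]` (constant outside this interval). -/
noncomputable def edgeMap (e : Γ.E) (t : ℝ) : Γ.Point :=
  if h₀ : t ≤ 0 then .vertex (Γ.src e)
  else if h₁ : Γ.len e ≤ t then .vertex (Γ.tgt e)
  else .interior e t (not_le.mp h₀) (not_le.mp h₁)

variable {Γ}

/-- A rational function on `Γ`: a continuous function which on every edge is piecewise linear with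
finitely many pieces and integer slopes. Here `B` is a finite set containing the break points; the
linearity on closed intervals free of interior break points contains the continuity. -/
def IsRational (f : Γ.Point → ℝ) : Prop :=
  ∀ e : Γ.E, ∃ B : Finset ℝ, ∀ x y : ℝ, 0 ≤ x → x ≤ y → y ≤ Γ.len e →
    (∀ z ∈ B, z ∉ Set.Ioo x y) →
    ∃ s : ℤ, ∀ t ∈ Set.Icc x y, f (Γ.edgeMap e t) = f (Γ.edgeMap e x) + s * (t - x)

/-- Slope of `f` along the edge `e` at parameter `t`, to the right of `t`. -/
noncomputable def rightSlope (f : Γ.Point → ℝ) (e : Γ.E) (t : ℝ) : ℝ :=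
  derivWithin (fun u => f (Γ.edgeMap e u)) (Set.Ioi t) t

/-- Slope of `f` along the edge `e` at parameter `t`, to the left of `t`. -/
noncomputable def leftSlope (f : Γ.Point → ℝ) (e : Γ.E) (t : ℝ) : ℝ :=
  derivWithin (fun u => f (Γ.edgeMap e u)) (Set.Iio t) t

open Classical in
/-- The order of `f` at a point: the sum of the outgoing slopes of `f` over all tangent directions
at that point. -/
noncomputable def ord (f : Γ.Point → ℝ) : Γ.Point → ℝ
  | .vertex v =>
      (∑ e with Γ.src e = v, rightSlope f e 0) + (∑ e with Γ.tgt e = v, -leftSlope f e (Γ.len e))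
  | .interior e t _ _ => rightSlope f e t + -leftSlope f e t

variable (Γ) in
/-- Divisors: the free abelian group on the points of `Γ`. -/
abbrev Divisor : Type := Γ.Point →₀ ℤ

/-- The degree of a divisor. -/
noncomputable def Divisor.deg (D : Γ.Divisor) : ℤ := D.sum fun _ c => c

/-- A divisor is effective if all its coefficients are nonnegative. -/
def Divisor.IsEffective (D : Γ.Divisor) : Prop := ∀ p, 0 ≤ D p

/-- Linear equivalence: the difference is the divisor of a rational function. -/
def Divisor.LinEquiv (D D' : Γ.Divisor) : Prop :=
  ∃ f : Γ.Point → ℝ, IsRational f ∧ ∀ p, ((D' p - D p : ℤ) : ℝ) = ord f p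

/-- `D` has (Baker–Norine) rank `r`: `r` is the largest integer `k` such that for every effective
divisor `E` of degree `k` the divisor `D - E` is linearly equivalent to an effective divisor.
For `k = -1` there is no such `E`, so `D` has rank `-1` if it is not equivalent to an effective
divisor. -/
def Divisor.HasRank (D : Γ.Divisor) (r : ℤ) : Prop :=
  IsGreatest {k : ℤ | ∀ E : Γ.Divisor, E.IsEffective → E.deg = k →
    ∃ D' : Γ.Divisor, D'.IsEffective ∧ (D - E).LinEquiv D'} r

/-- The metric complete bipartite graph `K_{m,n}` with all edge lengths equal to one. -/
def completeBipartite (m n : ℕ) : MetricGraph where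
  V := Fin m ⊕ Fin n
  E := Fin m × Fin n
  src e := .inl e.1
  tgt e := .inr e.2
  len _ := 1
  len_pos _ := one_pos

/-- The vertices `v_1, …, v_m` of `K_{m,n}` (indexed from `0`). -/
def vPoint (m n : ℕ) (i : Fin m) : (completeBipartite m n).Point := .vertex (.inl i)

/-- The vertices `w_1, …, w_n` of `K_{m,n}` (indexed from `0`). -/
def wPoint (m n : ℕ) (j : Fin n) : (completeBipartite m n).Point := .vertex (.inr j)

/-- The divisor `∑ b (v_i) + ∑ a (w_j)` on `K_{m,n}`. -/
noncomputable def bipartiteDivisor (m n : ℕ) (a b : ℤ) : (completeBipartite m n).Divisor :=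
  (∑ i : Fin m, Finsupp.single (vPoint m n i) b) + ∑ j : Fin n, Finsupp.single (wPoint m n j) a

end MetricGraph

/-! Write `D` for the divisor. The degree is a count; the rank needs two bounds.

Lower bound. It suffices to subtract effective divisors `E` supported on vertices
(`vertices_rank_determining`): if `D - u` and `D - v` are equivalent to effective divisors, where
`u` and `v` are the ends of an edge, then so is `D - p` for `p` on that edge. To see this, shift the
two rational functions so that they agree at `p` and take their maximum; this leaves a chip on
either side of `p` (or at `p`), and two such chips can be moved towards `p` until one arrives
(`exists_rational_sub_interior`). For `E` with coefficients `x i` and `y j` on the two sides,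
functions with integer vertex values that are affine on edges turn the question into chip firing
(`exists_firing`). Firing within one side moves multiples of `n` among the `x i`, or of `m` among
the `y j`, so these families may be assumed balanced, and after permuting, decreasing. If the degree
is less than `(a + 1) * (b + 1)`, then the last `x k` cells of each row `k` and the last `y l` cells
of each column `l` cannot cover an `(a + 1) × (b + 1)` grid (`exists_cell`). A cell `(k, l)` left
uncovered says how many vertices to fire on each side.

Upper bound. Subtract `b + 1` chips at each of `a + 1` of the `v_i`, and any surplus at one of them.
If `f` made the result effective, `f` would be convex on edges, hence maximal at a vertex. Maximal
vertices lose a chip along each edge to a vertex that is not maximal, and counting these losses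
contradicts effectivity (`not_exists_rational`). -/

open Filter Topology Set

/-! ### One-sided slopes of germs of piecewise linear functions -/

namespace MetricGraph

/-- Immediately to the right of `t`, the function `φ` is affine with slope `s`. -/
def RightSlopeAt (φ : ℝ → ℝ) (t s : ℝ) : Prop := ∀ᶠ u in 𝓝[>] t, φ u = φ t + s * (u - t)

/-- Immediately to the left of `t`, the function `φ` is affine with slope `s`. -/
def LeftSlopeAt (φ : ℝ → ℝ) (t s : ℝ) : Prop := ∀ᶠ u in 𝓝[<] t, φ u = φ t + s * (u - t)

lemma leftSlopeAt_iff {φ : ℝ → ℝ} {t s : ℝ} :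
    LeftSlopeAt φ t s ↔ RightSlopeAt (fun u => φ (-u)) (-t) (-s) := by
  constructor
  · intro h
    filter_upwards [tendsto_neg_nhdsGT_neg.eventually h] with u hu
    rw [hu, neg_neg]; ring
  · intro h
    filter_upwards [tendsto_neg_nhdsLT.eventually h] with u hu
    rw [neg_neg, neg_neg] at hu
    rw [hu]; ring

lemma RightSlopeAt.derivWithin_eq {φ : ℝ → ℝ} {t s : ℝ} (h : RightSlopeAt φ t s) :
    derivWithin φ (Ioi t) t = s := by
  have h1 : HasDerivWithinAt (fun u => φ t + s * (u - t)) s (Ioi t) t := by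
    have := (((hasDerivAt_id t).sub_const t).const_mul s).const_add (φ t)
    simpa using this.hasDerivWithinAt
  exact (h1.congr_of_eventuallyEq h (by simp)).derivWithin (uniqueDiffWithinAt_Ioi t)

lemma LeftSlopeAt.derivWithin_eq {φ : ℝ → ℝ} {t s : ℝ} (h : LeftSlopeAt φ t s) :
    derivWithin φ (Iio t) t = s := by
  have h1 : HasDerivWithinAt (fun u => φ t + s * (u - t)) s (Iio t) t := by
    have := (((hasDerivAt_id t).sub_const t).const_mul s).const_add (φ t)
    simpa using this.hasDerivWithinAt
  exact (h1.congr_of_eventuallyEq h (by simp)).derivWithin (uniqueDiffWithinAt_Iio t)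

lemma RightSlopeAt.continuousWithinAt {φ : ℝ → ℝ} {t s : ℝ} (h : RightSlopeAt φ t s) :
    ContinuousWithinAt φ (Ioi t) t := by
  have h1 : ContinuousWithinAt (fun u => φ t + s * (u - t)) (Ioi t) t := by fun_prop
  exact h1.congr_of_eventuallyEq h (by simp)

lemma LeftSlopeAt.continuousWithinAt {φ : ℝ → ℝ} {t s : ℝ} (h : LeftSlopeAt φ t s) :
    ContinuousWithinAt φ (Iio t) t := by
  have h1 : ContinuousWithinAt (fun u => φ t + s * (u - t)) (Iio t) t := by fun_prop
  exact h1.congr_of_eventuallyEq h (by simp)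

/-- Since `φ` is exactly affine near `t`, a single nearby point at which it lies above the line of
slope `r` compares the slopes. -/
lemma RightSlopeAt.le_of_frequently {φ : ℝ → ℝ} {t s r : ℝ} (h : RightSlopeAt φ t s)
    (h' : ∃ᶠ u in 𝓝[>] t, φ t + r * (u - t) ≤ φ u) : r ≤ s := by
  obtain ⟨u, h1, h2, h3⟩ := (h'.and_eventually (h.and self_mem_nhdsWithin)).exists
  have h3 : t < u := h3
  nlinarith

lemma LeftSlopeAt.le_of_frequently {φ : ℝ → ℝ} {t s r : ℝ} (h : LeftSlopeAt φ t s)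
    (h' : ∃ᶠ u in 𝓝[<] t, φ t + r * (u - t) ≤ φ u) : s ≤ r := by
  obtain ⟨u, h1, h2, h3⟩ := (h'.and_eventually (h.and self_mem_nhdsWithin)).exists
  have h3 : u < t := h3
  nlinarith

lemma RightSlopeAt.add {φ ψ : ℝ → ℝ} {t s r : ℝ} (h : RightSlopeAt φ t s)
    (h' : RightSlopeAt ψ t r) : RightSlopeAt (fun u => φ u + ψ u) t (s + r) := by
  filter_upwards [h, h'] with u h1 h2
  rw [h1, h2]; ring

lemma LeftSlopeAt.add {φ ψ : ℝ → ℝ} {t s r : ℝ} (h : LeftSlopeAt φ t s)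
    (h' : LeftSlopeAt ψ t r) : LeftSlopeAt (fun u => φ u + ψ u) t (s + r) := by
  filter_upwards [h, h'] with u h1 h2
  rw [h1, h2]; ring

lemma RightSlopeAt.neg {φ : ℝ → ℝ} {t s : ℝ} (h : RightSlopeAt φ t s) :
    RightSlopeAt (fun u => -φ u) t (-s) := by
  filter_upwards [h] with u h1
  rw [h1]; ring

lemma LeftSlopeAt.neg {φ : ℝ → ℝ} {t s : ℝ} (h : LeftSlopeAt φ t s) :
    LeftSlopeAt (fun u => -φ u) t (-s) := by
  filter_upwards [h] with u h1
  rw [h1]; ring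

lemma rightSlopeAt_affine (c r t : ℝ) : RightSlopeAt (fun u => c + r * u) t r :=
  Eventually.of_forall fun u => by ring

lemma leftSlopeAt_affine (c r t : ℝ) : LeftSlopeAt (fun u => c + r * u) t r :=
  Eventually.of_forall fun u => by ring

/-- Off a tie, continuity lets the larger function win near `t`. At a tie the slopes decide: the
steeper function wins on the right, and by reflection the one of smaller slope wins on the left. -/
lemma RightSlopeAt.max {φ ψ : ℝ → ℝ} {t s r : ℝ} (h : RightSlopeAt φ t s)
    (h' : RightSlopeAt ψ t r) :
    RightSlopeAt (fun u => max (φ u) (ψ u)) t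
      (if ψ t < φ t then s else if φ t < ψ t then r else max s r) := by
  split_ifs with h1 h2
  · filter_upwards [h, h'.continuousWithinAt.eventually_lt h.continuousWithinAt h1] with u h2 h3
    rw [max_eq_left h3.le, max_eq_left h1.le, h2]
  · filter_upwards [h', h.continuousWithinAt.eventually_lt h'.continuousWithinAt h2] with u h1 h3
    rw [max_eq_right h3.le, max_eq_right h2.le, h1]
  · have h3 : φ t = ψ t := le_antisymm (not_lt.1 h1) (not_lt.1 h2)
    filter_upwards [h, h', self_mem_nhdsWithin] with u h4 h5 h6
    have h6 : 0 ≤ u - t := sub_nonneg.2 (le_of_lt h6)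
    rw [h4, h5, h3, max_self, max_add_add_left, max_mul_of_nonneg _ _ h6]

lemma LeftSlopeAt.max {φ ψ : ℝ → ℝ} {t s r : ℝ} (h : LeftSlopeAt φ t s)
    (h' : LeftSlopeAt ψ t r) :
    LeftSlopeAt (fun u => max (φ u) (ψ u)) t
      (if ψ t < φ t then s else if φ t < ψ t then r else min s r) := by
  have := (leftSlopeAt_iff.1 h).max (leftSlopeAt_iff.1 h')
  rw [leftSlopeAt_iff]
  convert this using 1
  simp only [neg_neg]
  split_ifs <;> simp [max_neg_neg]

/-- `φ` is piecewise linear with integer slopes on `[0, L]`, phrased locally. -/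
structure PLOn (L : ℝ) (φ : ℝ → ℝ) : Prop where
  right : ∀ t, 0 ≤ t → t < L → ∃ s : ℤ, RightSlopeAt φ t s
  left : ∀ t, 0 < t → t ≤ L → ∃ s : ℤ, LeftSlopeAt φ t s

/-! ### Piecewise linear functions on an interval -/

namespace PLOn

variable {L : ℝ} {φ ψ : ℝ → ℝ}

lemma add (h : PLOn L φ) (h' : PLOn L ψ) : PLOn L (fun u => φ u + ψ u) where
  right t h0 h1 := by
    obtain ⟨s, hs⟩ := h.right t h0 h1
    obtain ⟨r, hr⟩ := h'.right t h0 h1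
    exact ⟨s + r, by simpa using hs.add hr⟩
  left t h0 h1 := by
    obtain ⟨s, hs⟩ := h.left t h0 h1
    obtain ⟨r, hr⟩ := h'.left t h0 h1
    exact ⟨s + r, by simpa using hs.add hr⟩

lemma neg (h : PLOn L φ) : PLOn L (fun u => -φ u) where
  right t h0 h1 := by
    obtain ⟨s, hs⟩ := h.right t h0 h1
    exact ⟨-s, by simpa using hs.neg⟩
  left t h0 h1 := by
    obtain ⟨s, hs⟩ := h.left t h0 h1
    exact ⟨-s, by simpa using hs.neg⟩

lemma affine (L c : ℝ) (r : ℤ) : PLOn L (fun u => c + r * u) where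
  right t _ _ := ⟨r, rightSlopeAt_affine c r t⟩
  left t _ _ := ⟨r, leftSlopeAt_affine c r t⟩

lemma const (L c : ℝ) : PLOn L (fun _ => c) := by simpa using affine L c 0

lemma max (h : PLOn L φ) (h' : PLOn L ψ) : PLOn L (fun u => max (φ u) (ψ u)) where
  right t h0 h1 := by
    obtain ⟨s, hs⟩ := h.right t h0 h1
    obtain ⟨r, hr⟩ := h'.right t h0 h1
    refine ⟨if ψ t < φ t then s else if φ t < ψ t then r else Max.max s r, ?_⟩
    convert hs.max hr using 1
    push_cast
    rfl
  left t h0 h1 := by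
    obtain ⟨s, hs⟩ := h.left t h0 h1
    obtain ⟨r, hr⟩ := h'.left t h0 h1
    refine ⟨if ψ t < φ t then s else if φ t < ψ t then r else Min.min s r, ?_⟩
    convert hs.max hr using 1
    push_cast
    rfl

lemma min (h : PLOn L φ) (h' : PLOn L ψ) : PLOn L (fun u => min (φ u) (ψ u)) := by
  have := (h.neg.max h'.neg).neg
  simpa [max_neg_neg] using this

lemma congr (h : PLOn L φ) (h' : ∀ u, 0 ≤ u → u ≤ L → ψ u = φ u) : PLOn L ψ where
  right t h0 h1 := by
    obtain ⟨s, hs⟩ := h.right t h0 h1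
    refine ⟨s, ?_⟩
    filter_upwards [hs, Ioo_mem_nhdsGT h1] with u h2 h3
    rw [h' u (h0.trans h3.1.le) h3.2.le, h' t h0 h1.le, h2]
  left t h0 h1 := by
    obtain ⟨s, hs⟩ := h.left t h0 h1
    refine ⟨s, ?_⟩
    filter_upwards [hs, Ioo_mem_nhdsLT h0] with u h2 h3
    rw [h' u h3.1.le (h3.2.le.trans h1), h' t h0.le h1, h2]

lemma continuousOn (h : PLOn L φ) : ContinuousOn φ (Icc 0 L) := by
  intro t ht
  have hl : ContinuousWithinAt φ (Icc 0 L ∩ Iic t) t := by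
    rcases ht.1.eq_or_lt with rfl | h0
    · refine continuousWithinAt_singleton.mono fun u hu => le_antisymm hu.2 hu.1.1
    · obtain ⟨s, hs⟩ := h.left t h0 ht.2
      exact (continuousWithinAt_Iio_iff_Iic.1 hs.continuousWithinAt).mono inter_subset_right
  have hr : ContinuousWithinAt φ (Icc 0 L ∩ Ici t) t := by
    rcases ht.2.eq_or_lt with rfl | h0
    · refine continuousWithinAt_singleton.mono fun u hu => le_antisymm hu.1.2 hu.2
    · obtain ⟨s, hs⟩ := h.right t ht.1 h0
      exact (continuousWithinAt_Ioi_iff_Ici.1 hs.continuousWithinAt).mono inter_subset_right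
  refine (hl.union hr).mono fun u hu => ?_
  rcases le_total u t with h | h
  exacts [Or.inl ⟨hu, h⟩, Or.inr ⟨hu, h⟩]

/-- A locally piecewise linear function has finitely many break points on a compact interval. -/
lemma exists_breakpoints (h : PLOn L φ) : ∃ B : Finset ℝ, ∀ x y : ℝ, 0 ≤ x → x ≤ y → y ≤ L →
    (∀ z ∈ B, z ∉ Ioo x y) → ∃ s : ℤ, ∀ t ∈ Icc x y, φ t = φ x + s * (t - x) := by
  -- Every `t` has a neighbourhood in which `φ` can break only at `t` itself; by compactness the
  -- centres of a finite subcover serve as `B`.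
  have hloc : ∀ t ∈ Icc (0 : ℝ) L, ∃ U ∈ 𝓝 t, ∀ z ∈ U ∩ Ioo 0 L, z ≠ t →
      ∃ s : ℤ, HasDerivAt φ s z ∧ ∀ᶠ w in 𝓝 z, HasDerivAt φ s w := by
    intro t ht
    have hR : ∃ U ∈ 𝓝 t, ∀ z ∈ U ∩ Ioo 0 L, t < z →
        ∃ s : ℤ, ∀ᶠ w in 𝓝 z, HasDerivAt φ s w := by
      rcases ht.2.eq_or_lt with rfl | h0
      · exact ⟨univ, univ_mem, fun z hz hz' => absurd hz.2.2 (not_lt.2 hz'.le)⟩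
      · obtain ⟨s, hs⟩ := h.right t ht.1 h0
        obtain ⟨b, hb, hb'⟩ := mem_nhdsGT_iff_exists_Ioo_subset.1 hs
        refine ⟨Iio b, Iio_mem_nhds hb, fun z hz hz' => ⟨s, ?_⟩⟩
        filter_upwards [Ioo_mem_nhds hz' hz.1] with w hw
        have h1 : HasDerivAt (fun u => φ t + s * (u - t)) s w := by
          simpa using (((hasDerivAt_id w).sub_const t).const_mul (s : ℝ)).const_add (φ t)
        refine h1.congr_of_eventuallyEq ?_
        filter_upwards [Ioo_mem_nhds hw.1 hw.2] with v hv using hb' hv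
    have hL : ∃ U ∈ 𝓝 t, ∀ z ∈ U ∩ Ioo 0 L, z < t →
        ∃ s : ℤ, ∀ᶠ w in 𝓝 z, HasDerivAt φ s w := by
      rcases ht.1.eq_or_lt with rfl | h0
      · exact ⟨univ, univ_mem, fun z hz hz' => absurd hz.2.1 (not_lt.2 hz'.le)⟩
      · obtain ⟨s, hs⟩ := h.left t h0 ht.2
        obtain ⟨b, hb, hb'⟩ := mem_nhdsLT_iff_exists_Ioo_subset.1 hs
        refine ⟨Ioi b, Ioi_mem_nhds hb, fun z hz hz' => ⟨s, ?_⟩⟩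
        filter_upwards [Ioo_mem_nhds hz.1 hz'] with w hw
        have h1 : HasDerivAt (fun u => φ t + s * (u - t)) s w := by
          simpa using (((hasDerivAt_id w).sub_const t).const_mul (s : ℝ)).const_add (φ t)
        refine h1.congr_of_eventuallyEq ?_
        filter_upwards [Ioo_mem_nhds hw.1 hw.2] with v hv using hb' hv
    obtain ⟨U, hU, hU'⟩ := hR
    obtain ⟨W, hW, hW'⟩ := hL
    refine ⟨U ∩ W, inter_mem hU hW, fun z hz hne => ?_⟩
    rcases lt_or_gt_of_ne hne with h1 | h1
    · obtain ⟨s, hs⟩ := hW' z ⟨hz.1.2, hz.2⟩ h1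
      exact ⟨s, hs.self_of_nhds, hs⟩
    · obtain ⟨s, hs⟩ := hU' z ⟨hz.1.1, hz.2⟩ h1
      exact ⟨s, hs.self_of_nhds, hs⟩
  choose! U hU hU' using hloc
  obtain ⟨B, hB, hB'⟩ := isCompact_Icc.elim_nhds_subcover U hU
  refine ⟨B, fun x y hx hxy hy hfree => ?_⟩
  rcases hxy.eq_or_lt with rfl | hlt
  · refine ⟨0, fun t ht => ?_⟩
    rw [le_antisymm ht.2 ht.1]; simp
  have hder : ∀ z ∈ Ioo x y, ∃ s : ℤ, HasDerivAt φ s z ∧ ∀ᶠ w in 𝓝 z, HasDerivAt φ s w := by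
    intro z hz
    have hz0 : z ∈ Ioo 0 L := ⟨hx.trans_lt hz.1, hz.2.trans_le hy⟩
    obtain ⟨t, ht, hzt⟩ := mem_iUnion₂.1 (hB' (Ioo_subset_Icc_self hz0))
    exact hU' t (hB t ht) z ⟨hzt, hz0⟩ (fun h => hfree t ht (h ▸ hz))
  have hpre : IsPreconnected (Ioo x y) := isPreconnected_Ioo
  have hmid : (x + y) / 2 ∈ Ioo x y := ⟨by linarith, by linarith⟩
  obtain ⟨s, hs, -⟩ := hder _ hmid
  have hconst : ∀ z ∈ Ioo x y, deriv φ z = s := by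
    intro z hz
    rw [← hs.deriv]
    -- The derivative of `φ` is locally constant on the open interval, which is connected, so a
    -- single integer slope serves there.
    have hd2 : ∀ w ∈ Ioo x y, HasDerivAt (deriv φ) 0 w := by
      intro w hw
      obtain ⟨r, -, h2⟩ := hder w hw
      refine (hasDerivAt_const w (r : ℝ)).congr_of_eventuallyEq ?_
      filter_upwards [h2] with v hv using hv.deriv
    exact isOpen_Ioo.is_const_of_deriv_eq_zero hpre
      (fun w hw => (hd2 w hw).differentiableAt.differentiableWithinAt)
      (fun w hw => (hd2 w hw).deriv) hz hmid
  refine ⟨s, fun t ht => ?_⟩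
  have hcont : ContinuousOn (fun u => φ u - s * u) (Icc x y) :=
    (h.continuousOn.mono (Icc_subset_Icc hx hy)).sub (by fun_prop)
  have hd : ∀ z ∈ Ioo x y, HasDerivAt (fun u => φ u - s * u) 0 z := by
    intro z hz
    obtain ⟨r, h1, -⟩ := hder z hz
    have h2 : HasDerivAt φ s z := by
      have := hconst z hz
      rw [h1.deriv] at this
      rwa [this] at h1
    have h3 := h2.sub ((hasDerivAt_id z).const_mul (s : ℝ))
    rw [mul_one, sub_self] at h3
    exact h3
  rcases ht.1.eq_or_lt with rfl | hxt
  · simp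
  obtain ⟨c, hc, hc'⟩ := exists_hasDerivAt_eq_slope (fun u => φ u - s * u) (fun _ => 0) hxt
    (hcont.mono (Icc_subset_Icc le_rfl ht.2)) fun z hz => hd z ⟨hz.1, hz.2.trans_le ht.2⟩
  rw [eq_comm, div_eq_zero_iff] at hc'
  rcases hc' with h1 | h1 <;> linarith

/-- A function all of whose breaks on `(0, L)` are convex lies below its chord. -/
lemma le_chord (h : PLOn L φ)
    (hconv : ∀ t, 0 < t → t < L → ∀ l r : ℝ, LeftSlopeAt φ t l → RightSlopeAt φ t r → l ≤ r)
    {t : ℝ} (h0 : 0 ≤ t) (h1 : t ≤ L) : L * φ t ≤ L * φ 0 + (φ L - φ 0) * t := by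
  by_contra! hlt
  set χ : ℝ → ℝ := fun u => L * φ u - (L * φ 0 + (φ L - φ 0) * u) with hχ
  have hL : 0 < L := by
    rcases (h0.trans h1).eq_or_lt with h2 | h2
    · have : t = 0 := le_antisymm (h2 ▸ h1) h0
      subst this; subst h2; simp at hlt
    · exact h2
  have hcont : ContinuousOn χ (Icc 0 L) :=
    (continuousOn_const.mul h.continuousOn).sub (by fun_prop)
  obtain ⟨x, hx, hxmax⟩ := isCompact_Icc.exists_isMaxOn ⟨t, h0, h1⟩ hcont
  -- The rightmost maximiser `z` of `χ` is needed: to its right `χ` drops strictly, while its left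
  -- slope at `z` is nonnegative, and convexity forbids this.
  have hcomp : IsCompact (Icc 0 L ∩ χ ⁻¹' {χ x}) := by
    refine isCompact_Icc.of_isClosed_subset ?_ inter_subset_left
    exact hcont.preimage_isClosed_of_isClosed isClosed_Icc isClosed_singleton
  obtain ⟨z, ⟨hz, hzx⟩, hzmax⟩ := hcomp.exists_isGreatest ⟨x, hx, rfl⟩
  have hzx : χ z = χ x := hzx
  have hpos : 0 < χ z := by
    rw [hzx]
    exact lt_of_lt_of_le (by simp only [hχ]; linarith) (hxmax (show t ∈ Icc 0 L from ⟨h0, h1⟩))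
  have hz0 : 0 < z := by
    refine lt_of_le_of_ne hz.1 fun h2 => ?_
    rw [← h2] at hpos; simp [hχ] at hpos
  have hzL : z < L := by
    refine lt_of_le_of_ne hz.2 fun h2 => ?_
    rw [h2] at hpos; simp only [hχ] at hpos; linarith
  obtain ⟨l, hl⟩ := h.left z hz0 hzL.le
  obtain ⟨r, hr⟩ := h.right z hz.1 hzL
  have hlr := hconv z hz0 hzL _ _ hl hr
  obtain ⟨u, hu1, hu2⟩ := (hl.and (Ioo_mem_nhdsLT hz0)).exists
  obtain ⟨v, hv1, hv2⟩ := (hr.and (Ioo_mem_nhdsGT hzL)).exists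
  have hu3 : χ u ≤ χ z := hzx ▸ hxmax (show u ∈ Icc 0 L from ⟨hu2.1.le, hu2.2.le.trans hz.2⟩)
  have hvm : v ∈ Icc 0 L := ⟨hz.1.trans hv2.1.le, hv2.2.le⟩
  have hv3 : χ v < χ z := by
    refine lt_of_le_of_ne (hzx ▸ hxmax hvm) fun h2 => ?_
    exact absurd (hzmax ⟨hvm, h2.trans hzx⟩) (not_le.2 hv2.1)
  simp only [hχ, hu1] at hu3
  simp only [hχ, hv1] at hv3
  have a1 : 0 ≤ L * l - (φ L - φ 0) := by nlinarith [hu2.2]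
  have a2 : L * r - (φ L - φ 0) < 0 := by nlinarith [hv2.1]
  nlinarith

/-- The maximal interval to the left of `t` on which `φ` is constant. -/
lemma exists_left_end (h : PLOn L φ) {t : ℝ} (h0 : 0 ≤ t) (h1 : t ≤ L) :
    ∃ x, 0 ≤ x ∧ x ≤ t ∧ (∀ u ∈ Icc x t, φ u = φ t) ∧ (0 < x → ¬ LeftSlopeAt φ x 0) := by
  set S : Set ℝ := {s | 0 ≤ s ∧ s ≤ t ∧ ∀ u ∈ Icc s t, φ u = φ t} with hS
  have hne : S.Nonempty := ⟨t, h0, le_rfl, fun u hu => by rw [le_antisymm hu.2 hu.1]⟩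
  have hbdd : BddBelow S := ⟨0, fun s hs => hs.1⟩
  have hmem : ∀ u, sInf S < u → u ≤ t → φ u = φ t := by
    intro u hu hut
    obtain ⟨s, hs, hsu⟩ := exists_lt_of_csInf_lt hne hu
    exact hs.2.2 u ⟨hsu.le, hut⟩
  have hx0 : 0 ≤ sInf S := le_csInf hne fun s hs => hs.1
  have hxt : sInf S ≤ t := csInf_le hbdd ⟨h0, le_rfl, fun u hu => by rw [le_antisymm hu.2 hu.1]⟩
  have hx : φ (sInf S) = φ t := by
    rcases hxt.eq_or_lt with h2 | h2
    · rw [h2]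
    obtain ⟨s, hs⟩ := h.right _ hx0 (h2.trans_le h1)
    refine tendsto_nhds_unique hs.continuousWithinAt (tendsto_const_nhds.congr' ?_)
    filter_upwards [Ioo_mem_nhdsGT h2] with u hu using (hmem u hu.1 hu.2.le).symm
  refine ⟨sInf S, hx0, hxt, fun u hu => ?_, fun hpos hl => ?_⟩
  · rcases hu.1.eq_or_lt with h2 | h2
    · rw [← h2, hx]
    · exact hmem u h2 hu.2
  -- Left slope zero at the infimum would prolong the interval of constancy further to the left.
  · obtain ⟨b, hb, hb'⟩ := mem_nhdsLT_iff_exists_Ioo_subset.1 hl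
    have hb : b < sInf S := hb
    have hm : Max.max b 0 < sInf S := max_lt hb hpos
    obtain ⟨c, hc, hc'⟩ := exists_between hm
    refine absurd (csInf_le hbdd (show c ∈ S from ⟨?_, (hc'.le.trans hxt), fun u hu => ?_⟩))
      (not_le.2 hc')
    · exact ((le_max_right _ _).trans_lt hc).le
    · rcases lt_trichotomy u (sInf S) with h2 | h2 | h2
      · have : φ u = _ := hb' ⟨((le_max_left _ _).trans_lt hc).trans_le hu.1, h2⟩
        rw [this, hx]; ring
      · rw [h2, hx]
      · exact hmem u h2 hu.2

lemma reflect (h : PLOn L φ) : PLOn L (fun u => φ (L - u)) where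
  right t h0 h1 := by
    obtain ⟨s, hs⟩ := h.left (L - t) (by linarith) (by linarith)
    refine ⟨-s, ?_⟩
    have : Tendsto (fun u => L - u) (𝓝[>] t) (𝓝[<] (L - t)) := by
      refine tendsto_nhdsWithin_iff.2 ⟨?_, ?_⟩
      · exact (Continuous.tendsto (by fun_prop) t).mono_left nhdsWithin_le_nhds
      · filter_upwards [self_mem_nhdsWithin] with u hu
        exact sub_lt_sub_left hu L
    filter_upwards [this.eventually hs] with u hu
    rw [hu]; push_cast; ring
  left t h0 h1 := by
    obtain ⟨s, hs⟩ := h.right (L - t) (by linarith) (by linarith)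
    refine ⟨-s, ?_⟩
    have : Tendsto (fun u => L - u) (𝓝[<] t) (𝓝[>] (L - t)) := by
      refine tendsto_nhdsWithin_iff.2 ⟨?_, ?_⟩
      · exact (Continuous.tendsto (by fun_prop) t).mono_left nhdsWithin_le_nhds
      · filter_upwards [self_mem_nhdsWithin] with u hu
        exact sub_lt_sub_left hu L
    filter_upwards [this.eventually hs] with u hu
    rw [hu]; push_cast; ring

/-- The maximal interval to the right of `t` on which `φ` is constant. -/
lemma exists_right_end (h : PLOn L φ) {t : ℝ} (h0 : 0 ≤ t) (h1 : t ≤ L) :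
    ∃ y, t ≤ y ∧ y ≤ L ∧ (∀ u ∈ Icc t y, φ u = φ t) ∧ (y < L → ¬ RightSlopeAt φ y 0) := by
  obtain ⟨x, hx0, hxt, hx, hx'⟩ :=
    h.reflect.exists_left_end (t := L - t) (by linarith) (by linarith)
  refine ⟨L - x, by linarith, by linarith, fun u hu => ?_, fun hlt hr => hx' (by linarith) ?_⟩
  · simpa using hx (L - u) ⟨by linarith [hu.2], by linarith [hu.1]⟩
  · have : Tendsto (fun u => L - u) (𝓝[<] x) (𝓝[>] (L - x)) := by
      refine tendsto_nhdsWithin_iff.2 ⟨?_, ?_⟩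
      · exact (Continuous.tendsto (by fun_prop) x).mono_left nhdsWithin_le_nhds
      · filter_upwards [self_mem_nhdsWithin] with u hu
        exact sub_lt_sub_left hu L
    filter_upwards [this.eventually hr] with u hu
    rw [hu]; ring

end PLOn

/-! ### Rational functions and their divisors -/

section Rational

variable {Γ : MetricGraph} {f g : Γ.Point → ℝ}

lemma edgeMap_zero (e : Γ.E) : Γ.edgeMap e 0 = .vertex (Γ.src e) := by simp [edgeMap]

lemma edgeMap_len (e : Γ.E) : Γ.edgeMap e (Γ.len e) = .vertex (Γ.tgt e) := by
  simp [edgeMap, Γ.len_pos e]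

lemma edgeMap_interior (e : Γ.E) {t : ℝ} (h₀ : 0 < t) (h₁ : t < Γ.len e) :
    Γ.edgeMap e t = .interior e t h₀ h₁ := by
  simp [edgeMap, h₀.not_ge, h₁.not_ge]

lemma IsRational.plOn (hf : IsRational f) (e : Γ.E) :
    PLOn (Γ.len e) (fun u => f (Γ.edgeMap e u)) := by
  obtain ⟨B, hB⟩ := hf e
  constructor
  · intro t h0 h1
    have hfree : ∀ᶠ y in 𝓝[>] t, ∀ z ∈ B, z ∉ Ioo t y := by
      rw [B.eventually_all]
      intro z _
      rcases le_or_gt z t with h | h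
      · exact Eventually.of_forall fun y hz => not_lt.2 h hz.1
      · filter_upwards [Ioo_mem_nhdsGT h] with y hy hz using lt_asymm hy.2 hz.2
    obtain ⟨y, hy, hy'⟩ := (hfree.and (Ioo_mem_nhdsGT h1)).exists
    obtain ⟨s, hs⟩ := hB t y h0 hy'.1.le hy'.2.le hy
    refine ⟨s, ?_⟩
    filter_upwards [Ioo_mem_nhdsGT hy'.1] with u hu using hs u (Ioo_subset_Icc_self hu)
  · intro t h0 h1
    have hfree : ∀ᶠ y in 𝓝[<] t, ∀ z ∈ B, z ∉ Ioo y t := by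
      rw [B.eventually_all]
      intro z _
      rcases le_or_gt t z with h | h
      · exact Eventually.of_forall fun y hz => not_lt.2 h hz.2
      · filter_upwards [Ioo_mem_nhdsLT h] with y hy hz using lt_asymm hy.1 hz.1
    obtain ⟨y, hy, hy'⟩ := (hfree.and (Ioo_mem_nhdsLT h0)).exists
    obtain ⟨s, hs⟩ := hB y t hy'.1.le hy'.2.le h1 hy
    refine ⟨s, ?_⟩
    filter_upwards [Ioo_mem_nhdsLT hy'.2] with u hu
    rw [hs u (Ioo_subset_Icc_self hu), hs t ⟨hy'.2.le, le_rfl⟩]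
    ring

/-- Compactness of the edge makes the local condition equivalent to the one with finitely many break
points. The local one is visibly stable under sums and maxima. -/
lemma isRational_iff_plOn :
    IsRational f ↔ ∀ e, PLOn (Γ.len e) (fun u => f (Γ.edgeMap e u)) :=
  ⟨fun h => h.plOn, fun h e => (h e).exists_breakpoints⟩

lemma IsRational.add (hf : IsRational f) (hg : IsRational g) : IsRational (fun p => f p + g p) :=
  isRational_iff_plOn.2 fun e => (hf.plOn e).add (hg.plOn e)

lemma IsRational.max (hf : IsRational f) (hg : IsRational g) :
    IsRational (fun p => max (f p) (g p)) :=
  isRational_iff_plOn.2 fun e => (hf.plOn e).max (hg.plOn e)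

lemma isRational_const (c : ℝ) : IsRational (fun _ : Γ.Point => c) :=
  isRational_iff_plOn.2 fun _ => PLOn.const _ c

lemma rightSlope_eq {e : Γ.E} {t s : ℝ} (h : RightSlopeAt (fun u => f (Γ.edgeMap e u)) t s) :
    rightSlope f e t = s := h.derivWithin_eq

lemma leftSlope_eq {e : Γ.E} {t s : ℝ} (h : LeftSlopeAt (fun u => f (Γ.edgeMap e u)) t s) :
    leftSlope f e t = s := h.derivWithin_eq

lemma IsRational.rightSlope_spec (hf : IsRational f) (e : Γ.E) {t : ℝ} (h0 : 0 ≤ t)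
    (h1 : t < Γ.len e) : RightSlopeAt (fun u => f (Γ.edgeMap e u)) t (rightSlope f e t) := by
  obtain ⟨s, hs⟩ := (hf.plOn e).right t h0 h1
  rwa [rightSlope_eq hs]

lemma IsRational.leftSlope_spec (hf : IsRational f) (e : Γ.E) {t : ℝ} (h0 : 0 < t)
    (h1 : t ≤ Γ.len e) : LeftSlopeAt (fun u => f (Γ.edgeMap e u)) t (leftSlope f e t) := by
  obtain ⟨s, hs⟩ := (hf.plOn e).left t h0 h1
  rwa [leftSlope_eq hs]

lemma IsRational.exists_rightSlope_eq (hf : IsRational f) (e : Γ.E) {t : ℝ} (h0 : 0 ≤ t)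
    (h1 : t < Γ.len e) : ∃ s : ℤ, rightSlope f e t = s := by
  obtain ⟨s, hs⟩ := (hf.plOn e).right t h0 h1
  exact ⟨s, rightSlope_eq hs⟩

lemma IsRational.exists_leftSlope_eq (hf : IsRational f) (e : Γ.E) {t : ℝ} (h0 : 0 < t)
    (h1 : t ≤ Γ.len e) : ∃ s : ℤ, leftSlope f e t = s := by
  obtain ⟨s, hs⟩ := (hf.plOn e).left t h0 h1
  exact ⟨s, leftSlope_eq hs⟩

lemma IsRational.exists_ord_eq (hf : IsRational f) (p : Γ.Point) : ∃ k : ℤ, ord f p = k := by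
  classical
  cases p with
  | vertex v =>
    choose r hr using fun e => hf.exists_rightSlope_eq e le_rfl (Γ.len_pos e)
    choose l hl using fun e => hf.exists_leftSlope_eq e (Γ.len_pos e) le_rfl
    refine ⟨(∑ e with Γ.src e = v, r e) + ∑ e with Γ.tgt e = v, -l e, ?_⟩
    simp only [ord, hr, hl]
    push_cast
    congr
  | interior e t h0 h1 =>
    obtain ⟨r, hr⟩ := hf.exists_rightSlope_eq e h0.le h1
    obtain ⟨l, hl⟩ := hf.exists_leftSlope_eq e h0 h1.le
    exact ⟨r + -l, by simp [ord, hr, hl]⟩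

lemma ord_add (hf : IsRational f) (hg : IsRational g) (p : Γ.Point) :
    ord (fun q => f q + g q) p = ord f p + ord g p := by
  have hr : ∀ (e : Γ.E) (t : ℝ), 0 ≤ t → t < Γ.len e →
      rightSlope (fun q => f q + g q) e t = rightSlope f e t + rightSlope g e t :=
    fun e t h0 h1 => rightSlope_eq ((hf.rightSlope_spec e h0 h1).add (hg.rightSlope_spec e h0 h1))
  have hl : ∀ (e : Γ.E) (t : ℝ), 0 < t → t ≤ Γ.len e →
      leftSlope (fun q => f q + g q) e t = leftSlope f e t + leftSlope g e t :=
    fun e t h0 h1 => leftSlope_eq ((hf.leftSlope_spec e h0 h1).add (hg.leftSlope_spec e h0 h1))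
  cases p with
  | vertex v =>
    simp only [ord, hr _ _ le_rfl (Γ.len_pos _), hl _ _ (Γ.len_pos _) le_rfl, neg_add,
      Finset.sum_add_distrib]
    ring
  | interior e t h0 h1 =>
    simp only [ord, hr e t h0.le h1, hl e t h0 h1.le]
    ring

lemma ord_const (c : ℝ) (p : Γ.Point) : ord (fun _ => c) p = 0 := by
  cases p <;> simp [ord, rightSlope, leftSlope]

lemma ord_add_const (hf : IsRational f) (c : ℝ) (p : Γ.Point) :
    ord (fun q => f q + c) p = ord f p := by
  rw [ord_add hf (isRational_const c), ord_const, add_zero]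

lemma rightSlope_le (hf : IsRational f) (hg : IsRational g) (hle : ∀ p, f p ≤ g p) {e : Γ.E}
    {t : ℝ} (h0 : 0 ≤ t) (h1 : t < Γ.len e) (heq : f (Γ.edgeMap e t) = g (Γ.edgeMap e t)) :
    rightSlope f e t ≤ rightSlope g e t := by
  refine (hg.rightSlope_spec e h0 h1).le_of_frequently (Eventually.frequently ?_)
  filter_upwards [hf.rightSlope_spec e h0 h1] with u hu
  rw [← heq, ← hu]
  exact hle _

lemma leftSlope_le (hf : IsRational f) (hg : IsRational g) (hle : ∀ p, f p ≤ g p) {e : Γ.E}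
    {t : ℝ} (h0 : 0 < t) (h1 : t ≤ Γ.len e) (heq : f (Γ.edgeMap e t) = g (Γ.edgeMap e t)) :
    leftSlope g e t ≤ leftSlope f e t := by
  refine (hg.leftSlope_spec e h0 h1).le_of_frequently (Eventually.frequently ?_)
  filter_upwards [hf.leftSlope_spec e h0 h1] with u hu
  rw [← heq, ← hu]
  exact hle _

/-- If `f ≤ g` with equality at `p`, then `ord f p ≤ ord g p`. -/
lemma ord_le_ord (hf : IsRational f) (hg : IsRational g) (hle : ∀ p, f p ≤ g p) {p : Γ.Point}
    (heq : f p = g p) : ord f p ≤ ord g p := by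
  classical
  cases p with
  | vertex v =>
    refine add_le_add (Finset.sum_le_sum fun e he => ?_) (Finset.sum_le_sum fun e he => ?_)
    · rw [Finset.mem_filter] at he
      exact rightSlope_le hf hg hle le_rfl (Γ.len_pos e) (by rwa [edgeMap_zero, he.2])
    · rw [Finset.mem_filter] at he
      exact neg_le_neg (leftSlope_le hf hg hle (Γ.len_pos e) le_rfl (by rwa [edgeMap_len, he.2]))
  | interior e t h0 h1 =>
    have heq' : f (Γ.edgeMap e t) = g (Γ.edgeMap e t) := by rwa [edgeMap_interior e h0 h1]
    exact add_le_add (rightSlope_le hf hg hle h0.le h1 heq')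
      (neg_le_neg (leftSlope_le hf hg hle h0 h1.le heq'))

/-- The principal divisor of a rational function. -/
lemma IsRational.exists_divisor (hf : IsRational f) : ∃ P : Γ.Divisor, ∀ p, (P p : ℝ) = ord f p := by
  classical
  choose k hk using hf.exists_ord_eq
  choose B hB using hf
  have hfin : (Function.support k).Finite := by
    have hS : (range (Point.vertex : Γ.V → Γ.Point) ∪
        ⋃ e, Γ.edgeMap e '' (B e : Set ℝ)).Finite :=
      (finite_range _).union (finite_iUnion fun e => (B e).finite_toSet.image _)
    refine hS.subset fun p hp => ?_
    cases p with
    | vertex v => exact Or.inl ⟨v, rfl⟩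
    | interior e t h0 h1 =>
      refine Or.inr (mem_iUnion.2 ⟨e, t, ?_, edgeMap_interior e h0 h1⟩)
      by_contra hB'
      refine hp ?_
      -- Away from the break points `f` is affine on a two-sided neighbourhood of `t`, so the two
      -- outgoing slopes cancel. The support thus consists of vertices and break points.
      have hfree : ∀ᶠ ε in 𝓝[>] (0 : ℝ), ∀ z ∈ B e, z ∉ Ioo (t - ε) (t + ε) := by
        rw [(B e).eventually_all]
        intro z hz
        have hne : 0 < |z - t| := by
          rw [abs_pos, sub_ne_zero]
          rintro rfl
          exact hB' hz
        filter_upwards [Ioo_mem_nhdsGT hne] with ε hε hz'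
        refine lt_asymm hε.2 ?_
        rw [abs_lt]
        exact ⟨by linarith [hz'.1], by linarith [hz'.2]⟩
      obtain ⟨ε, hε, hε0, hε1⟩ := (hfree.and (Ioo_mem_nhdsGT
        (show 0 < min t (Γ.len e - t) from lt_min h0 (sub_pos.2 h1)))).exists
      rw [lt_min_iff] at hε1
      obtain ⟨s, hs⟩ := hB e (t - ε) (t + ε) (by linarith) (by linarith) (by linarith) hε
      have hst := hs t ⟨by linarith, by linarith⟩
      have hr : rightSlope f e t = s := rightSlope_eq <| by
        filter_upwards [Ioo_mem_nhdsGT (show t < t + ε by linarith)] with u hu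
        rw [hs u ⟨by linarith [hu.1], hu.2.le⟩, hst]; ring
      have hl : leftSlope f e t = s := leftSlope_eq <| by
        filter_upwards [Ioo_mem_nhdsLT (show t - ε < t by linarith)] with u hu
        rw [hs u ⟨hu.1.le, by linarith [hu.2]⟩, hst]; ring
      have := hk (.interior e t h0 h1)
      simp only [ord, hr, hl, add_neg_cancel] at this
      exact_mod_cast this.symm
  exact ⟨Finsupp.ofSupportFinite k hfin, fun p => (hk p).symm⟩

/-- `D` is linearly equivalent to an effective divisor, in terms of rational functions only. -/
lemma exists_linEquiv_effective_iff {D : Γ.Divisor} :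
    (∃ D' : Γ.Divisor, D'.IsEffective ∧ D.LinEquiv D') ↔
      ∃ f : Γ.Point → ℝ, IsRational f ∧ ∀ p, 0 ≤ (D p : ℝ) + ord f p := by
  constructor
  · rintro ⟨D', hD', f, hf, h⟩
    refine ⟨f, hf, fun p => ?_⟩
    rw [← h p]
    push_cast
    have : (0 : ℝ) ≤ D' p := by exact_mod_cast hD' p
    linarith
  · rintro ⟨f, hf, h⟩
    obtain ⟨P, hP⟩ := hf.exists_divisor
    refine ⟨D + P, fun p => ?_, f, hf, fun p => ?_⟩
    · have := h p
      rw [← hP p] at this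
      simpa using (by exact_mod_cast this : 0 ≤ D p + P p)
    · simp [hP]

end Rational

/-! ### Moving two chips towards a point between them -/

section Tent

variable (x t y : ℝ)

/-- The function that moves one chip from `x` and one chip from `y` towards `t ∈ (x, y)` at unit
speed, until one of them arrives. -/
noncomputable def tent (s : ℝ) : ℝ :=
  min 0 (max (max (x - s) (s - y)) (-min (t - x) (y - t)))

variable {x t y}

lemma tent_of_le {s : ℝ} (h : s ≤ x) : tent x t y s = 0 :=
  min_eq_left (le_max_of_le_left (le_max_of_le_left (sub_nonneg.2 h)))

lemma tent_of_ge {s : ℝ} (h : y ≤ s) : tent x t y s = 0 :=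
  min_eq_left (le_max_of_le_left (le_max_of_le_right (sub_nonneg.2 h)))

lemma tent_eq (hx : x ≤ t) (hy : t ≤ y) {s : ℝ} (h : x ≤ s) (h' : s ≤ y) :
    tent x t y s = max (max (x - s) (s - y)) (-min (t - x) (y - t)) := by
  refine min_eq_right (max_le (max_le (sub_nonpos.2 h) (sub_nonpos.2 h')) ?_)
  exact neg_nonpos.2 (le_min (sub_nonneg.2 hx) (sub_nonneg.2 hy))

lemma plOn_tent (L : ℝ) : PLOn L (tent x t y) := by
  refine (PLOn.const L 0).min (((?_ : PLOn L fun s => x - s).max ?_).max (PLOn.const L _))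
  · simpa [sub_eq_add_neg] using PLOn.affine L x (-1)
  · simpa [sub_eq_add_neg, add_comm] using PLOn.affine L (-y) 1

lemma tent_right_zero (hx : x < t) (hy : t < y) (h0 : 0 ≤ x) :
    RightSlopeAt (tent x t y) 0 (if x = 0 then -1 else 0) := by
  have hδ : 0 < min (t - x) (y - t) := lt_min (sub_pos.2 hx) (sub_pos.2 hy)
  split_ifs with h
  · subst h
    filter_upwards [Ioo_mem_nhdsGT hδ] with u hu
    have h1 := min_le_left (t - 0) (y - t)
    have h2 := min_le_right (t - 0) (y - t)
    have h3 := hu.1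
    have h4 := hu.2
    rw [tent_of_le le_rfl, tent_eq hx.le hy.le h3.le (by linarith), max_eq_left (a := 0 - u),
      max_eq_left] <;> linarith
  · filter_upwards [Ioo_mem_nhdsGT (lt_of_le_of_ne h0 (Ne.symm h))] with u hu
    rw [tent_of_le h0, tent_of_le hu.2.le]; ring

lemma tent_left_end (hx : x < t) (hy : t < y) {L : ℝ} (h0 : y ≤ L) :
    LeftSlopeAt (tent x t y) L (if y = L then 1 else 0) := by
  have hδ : 0 < min (t - x) (y - t) := lt_min (sub_pos.2 hx) (sub_pos.2 hy)
  split_ifs with h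
  · subst h
    filter_upwards [Ioo_mem_nhdsLT (sub_lt_self y hδ)] with u hu
    have h1 := min_le_left (t - x) (y - t)
    have h2 := min_le_right (t - x) (y - t)
    have h3 := hu.1
    have h4 := hu.2
    rw [tent_of_ge le_rfl, tent_eq hx.le hy.le (by linarith) h4.le, max_eq_right (b := u - y),
      max_eq_left] <;> linarith
  · filter_upwards [Ioo_mem_nhdsLT (lt_of_le_of_ne h0 h)] with u hu
    rw [tent_of_ge h0, tent_of_ge hu.1.le]; ring

/-- On `[x, y]` the tent has slopes `-1`, `0`, `1`, with convex breaks at distance `min (t - x) (y -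
t)` from `x` and from `y`; one of these is `t`. A lower bound suffices, because the chip arriving at
the other break does no harm. -/
lemma tent_break (hx : x < t) (hy : t < y) {s l r : ℝ} (hl : LeftSlopeAt (tent x t y) s l)
    (hr : RightSlopeAt (tent x t y) s r) :
    ((if s = t then 1 else 0) - (if s = x then 1 else 0) - (if s = y then 1 else 0) : ℝ) ≤ r - l := by
  have hδ : 0 < min (t - x) (y - t) := lt_min (sub_pos.2 hx) (sub_pos.2 hy)
  have hδ1 := min_le_left (t - x) (y - t)
  have hδ2 := min_le_right (t - x) (y - t)
  set δ := min (t - x) (y - t) with hδd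
  -- An affine function touching the tent from below at `s` has slope between `l` and `r`. At `s =
  -- t` two such functions, with slopes differing by one, touch.
  have lower : ∀ α : ℝ, (∀ᶠ u in 𝓝 s, tent x t y s + α * (u - s) ≤ tent x t y u) →
      α ≤ r ∧ l ≤ α := fun α h =>
    ⟨hr.le_of_frequently (h.filter_mono nhdsWithin_le_nhds).frequently,
      hl.le_of_frequently (h.filter_mono nhdsWithin_le_nhds).frequently⟩
  rcases lt_or_ge s x with h1 | h1
  · have : l = 0 ∧ r = 0 := by
      rw [← hl.derivWithin_eq, ← hr.derivWithin_eq]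
      have : tent x t y =ᶠ[𝓝 s] fun _ => 0 := by
        filter_upwards [Iio_mem_nhds h1] with u hu using tent_of_le (le_of_lt hu)
      rw [(this.filter_mono nhdsWithin_le_nhds).derivWithin_eq this.self_of_nhds,
        (this.filter_mono nhdsWithin_le_nhds).derivWithin_eq this.self_of_nhds]
      simp
    rw [this.1, this.2, if_neg (by linarith), if_neg (by linarith), if_neg (by linarith)]
    norm_num
  rcases h1.eq_or_lt with rfl | h1
  · have h2 : l ≤ 0 := by
      refine hl.le_of_frequently (Eventually.frequently ?_)
      filter_upwards [self_mem_nhdsWithin] with u hu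
      rw [tent_of_le le_rfl, tent_of_le (le_of_lt hu)]; simp
    have h3 : -1 ≤ r := by
      refine hr.le_of_frequently (Eventually.frequently ?_)
      filter_upwards [Ioo_mem_nhdsGT (hx.trans hy)] with u hu
      rw [tent_of_le le_rfl, tent_eq hx.le hy.le hu.1.le hu.2.le]
      exact le_max_of_le_left (le_max_of_le_left (by linarith))
    rw [if_neg (by linarith), if_pos rfl, if_neg (by linarith)]
    linarith
  rcases lt_or_ge y s with h2 | h2
  · have : l = 0 ∧ r = 0 := by
      rw [← hl.derivWithin_eq, ← hr.derivWithin_eq]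
      have : tent x t y =ᶠ[𝓝 s] fun _ => 0 := by
        filter_upwards [Ioi_mem_nhds h2] with u hu using tent_of_ge (le_of_lt hu)
      rw [(this.filter_mono nhdsWithin_le_nhds).derivWithin_eq this.self_of_nhds,
        (this.filter_mono nhdsWithin_le_nhds).derivWithin_eq this.self_of_nhds]
      simp
    rw [this.1, this.2, if_neg (by linarith), if_neg (by linarith), if_neg (by linarith)]
    norm_num
  rcases h2.eq_or_lt with rfl | h2
  · have h2 : 0 ≤ r := by
      refine hr.le_of_frequently (Eventually.frequently ?_)
      filter_upwards [self_mem_nhdsWithin] with u hu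
      rw [tent_of_ge le_rfl, tent_of_ge (le_of_lt hu)]; simp
    have h3 : l ≤ 1 := by
      refine hl.le_of_frequently (Eventually.frequently ?_)
      filter_upwards [Ioo_mem_nhdsLT (hx.trans hy)] with u hu
      rw [tent_of_ge le_rfl, tent_eq hx.le hy.le hu.1.le hu.2.le]
      exact le_max_of_le_left (le_max_of_le_right (by linarith))
    rw [if_neg (by linarith), if_neg (by linarith), if_pos rfl]
    linarith
  have near : ∀ᶠ u in 𝓝 s, tent x t y u = max (max (x - u) (u - y)) (-δ) := by
    filter_upwards [Ioo_mem_nhds h1 h2] with u hu using tent_eq hx.le hy.le hu.1.le hu.2.le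
  have hs := near.self_of_nhds
  have left_piece : tent x t y s = x - s → -1 ≤ r ∧ l ≤ -1 := fun h => lower _ <| by
    filter_upwards [near] with u hu
    rw [hu, h]
    exact le_max_of_le_left (le_max_of_le_left (by linarith))
  have right_piece : tent x t y s = s - y → 1 ≤ r ∧ l ≤ 1 := fun h => lower _ <| by
    filter_upwards [near] with u hu
    rw [hu, h]
    exact le_max_of_le_left (le_max_of_le_right (by linarith))
  have mid_piece : tent x t y s = -δ → 0 ≤ r ∧ l ≤ 0 := fun h => lower _ <| by
    filter_upwards [near] with u hu
    rw [hu, h]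
    exact le_max_of_le_right (by linarith)
  rw [if_neg h1.ne', if_neg h2.ne]
  split_ifs with hst
  · subst hst
    have h3 : tent x s y s = -δ := by
      rw [hs]; exact max_eq_right (max_le (by linarith) (by linarith))
    rcases min_choice (s - x) (y - s) with h4 | h4
    · linarith [(left_piece (by linarith)).2, (mid_piece h3).1]
    · linarith [(right_piece (by linarith)).1, (mid_piece h3).2]
  · rcases max_choice (max (x - s) (s - y)) (-δ) with h3 | h3
    · rcases max_choice (x - s) (s - y) with h4 | h4
      · linarith [left_piece (by rw [hs, h3, h4])]
      · linarith [right_piece (by rw [hs, h3, h4])]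
    · linarith [mid_piece (by rw [hs, h3])]

end Tent

/-! ### The vertices determine the rank -/

section RankDetermining

variable {Γ : MetricGraph}

lemma interior_eq_edgeMap_iff {e e' : Γ.E} {s x : ℝ} (h0 : 0 < s) (h1 : s < Γ.len e') :
    Point.interior e' s h0 h1 = Γ.edgeMap e x ↔ e' = e ∧ s = x := by
  constructor
  · intro h
    unfold edgeMap at h
    split_ifs at h
    injection h with h2 h3
    exact ⟨h2, h3⟩
  · rintro ⟨rfl, rfl⟩
    rw [edgeMap_interior e' h0 h1]

-- The tent is extended by zero off `e`. When `x` or `y` is an end of `e`, the chip is taken from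
-- that vertex along `e` alone.
open Classical in
lemma exists_tent (e : Γ.E) {x t y : ℝ} (h0 : 0 ≤ x) (hx : x < t) (hy : t < y)
    (h1 : y ≤ Γ.len e) : ∃ τ : Γ.Point → ℝ, IsRational τ ∧ ∀ q,
      ((if q = Γ.edgeMap e t then 1 else 0) - (if q = Γ.edgeMap e x then 1 else 0)
        - (if q = Γ.edgeMap e y then 1 else 0) : ℝ) ≤ ord τ q := by
  let τ : Γ.Point → ℝ := fun q => match q with
    | .vertex _ => 0
    | .interior e' s _ _ => if e' = e then tent x t y s else 0
  have hτe : ∀ s, 0 ≤ s → s ≤ Γ.len e → τ (Γ.edgeMap e s) = tent x t y s := by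
    intro s hs0 hs1
    rcases hs0.eq_or_lt with rfl | hs0
    · rw [edgeMap_zero, tent_of_le h0]
    rcases hs1.eq_or_lt with rfl | hs1
    · rw [edgeMap_len, tent_of_ge h1]
    · rw [edgeMap_interior e hs0 hs1]; simp [τ]
  have hτ0 : ∀ e', e' ≠ e → ∀ s, τ (Γ.edgeMap e' s) = 0 := by
    intro e' he s
    unfold edgeMap
    split_ifs <;> simp [τ, he]
  have hτ : IsRational τ := by
    refine isRational_iff_plOn.2 fun e' => ?_
    by_cases he : e' = e
    · subst he
      exact (plOn_tent _).congr hτe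
    · simpa only [hτ0 e' he] using PLOn.const _ 0
  have hr0 : ∀ e' s, e' ≠ e → rightSlope τ e' s = 0 := fun e' s he => by
    simp [rightSlope, hτ0 e' he]
  have hl0 : ∀ e' s, e' ≠ e → leftSlope τ e' s = 0 := fun e' s he => by
    simp [leftSlope, hτ0 e' he]
  have hr : ∀ s, 0 ≤ s → s < Γ.len e → RightSlopeAt (tent x t y) s (rightSlope τ e s) := by
    intro s hs0 hs1
    filter_upwards [hτ.rightSlope_spec e hs0 hs1, Ioo_mem_nhdsGT hs1] with u hu hu'
    rwa [hτe u (hs0.trans hu'.1.le) hu'.2.le, hτe s hs0 hs1.le] at hu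
  have hl : ∀ s, 0 < s → s ≤ Γ.len e → LeftSlopeAt (tent x t y) s (leftSlope τ e s) := by
    intro s hs0 hs1
    filter_upwards [hτ.leftSlope_spec e hs0 hs1, Ioo_mem_nhdsLT hs0] with u hu hu'
    rwa [hτe u hu'.1.le (hu'.2.le.trans hs1), hτe s hs0.le hs1] at hu
  refine ⟨τ, hτ, fun q => ?_⟩
  cases q with
  | vertex v =>
    have hr' : ∀ e', rightSlope τ e' 0 = if e' = e then (if x = 0 then -1 else 0) else 0 := by
      intro e'
      split_ifs with he hx0
      · subst he
        have := tent_right_zero hx hy h0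
        rw [if_pos hx0] at this
        exact (hr 0 le_rfl (Γ.len_pos _)).derivWithin_eq.symm.trans this.derivWithin_eq
      · subst he
        have := tent_right_zero hx hy h0
        rw [if_neg hx0] at this
        exact (hr 0 le_rfl (Γ.len_pos _)).derivWithin_eq.symm.trans this.derivWithin_eq
      · exact hr0 e' 0 he
    have hl' : ∀ e', -leftSlope τ e' (Γ.len e') =
        if e' = e then (if y = Γ.len e then -1 else 0) else 0 := by
      intro e'
      split_ifs with he hy0
      · subst he
        have := tent_left_end hx hy h1
        rw [if_pos hy0] at this
        rw [← (hl _ (Γ.len_pos _) le_rfl).derivWithin_eq, this.derivWithin_eq]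
      · subst he
        have := tent_left_end hx hy h1
        rw [if_neg hy0] at this
        rw [← (hl _ (Γ.len_pos _) le_rfl).derivWithin_eq, this.derivWithin_eq, neg_zero]
      · rw [hl0 e' _ he, neg_zero]
    simp only [ord, hr', hl', Finset.sum_ite_eq', Finset.mem_filter, Finset.mem_univ, true_and]
    rw [if_neg (by rw [edgeMap_interior e (h0.trans_lt hx) (hy.trans_le h1)]; simp)]
    have hX : (if x = 0 then (if Γ.src e = v then 1 else 0) else 0 : ℝ) ≤
        if Point.vertex v = Γ.edgeMap e x then 1 else 0 := by
      by_cases h : x = 0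
      · rw [if_pos h, h, edgeMap_zero]
        by_cases h' : Γ.src e = v
        · simp [h']
        · rw [if_neg h']; split_ifs <;> norm_num
      · rw [if_neg h]; split_ifs <;> norm_num
    have hY : (if y = Γ.len e then (if Γ.tgt e = v then 1 else 0) else 0 : ℝ) ≤
        if Point.vertex v = Γ.edgeMap e y then 1 else 0 := by
      by_cases h : y = Γ.len e
      · rw [if_pos h, h, edgeMap_len]
        by_cases h' : Γ.tgt e = v
        · simp [h']
        · rw [if_neg h']; split_ifs <;> norm_num
      · rw [if_neg h]; split_ifs <;> norm_num
    have hX' : (if Γ.src e = v then (if x = 0 then -1 else 0) else 0 : ℝ) =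
      -(if x = 0 then (if Γ.src e = v then 1 else 0) else 0 : ℝ) := by split_ifs <;> norm_num
    have hY' : (if Γ.tgt e = v then (if y = Γ.len e then -1 else 0) else 0 : ℝ) =
      -(if y = Γ.len e then (if Γ.tgt e = v then 1 else 0) else 0 : ℝ) := by
      split_ifs <;> norm_num
    rw [hX', hY']
    linarith
  | interior e' s hs0 hs1 =>
    simp only [interior_eq_edgeMap_iff]
    by_cases he : e' = e
    · subst he
      simpa [ord, sub_eq_add_neg] using tent_break hx hy (hl s hs0 hs1.le) (hr s hs0.le hs1)
    · simp [ord, he, hr0 e' s he, hl0 e' s he]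

lemma edgeMap_injOn {e : Γ.E} (he : Γ.src e ≠ Γ.tgt e) : InjOn (Γ.edgeMap e) (Icc 0 (Γ.len e)) := by
  intro s hs r hr h
  rcases hs.1.eq_or_lt with rfl | hs0
  · rcases hr.1.eq_or_lt with rfl | hr0
    · rfl
    rcases hr.2.eq_or_lt with rfl | hr1
    · rw [edgeMap_zero, edgeMap_len] at h
      injection h with h
      exact absurd h he
    · rw [edgeMap_zero, edgeMap_interior e hr0 hr1] at h
      cases h
  rcases hs.2.eq_or_lt with rfl | hs1
  · rcases hr.1.eq_or_lt with rfl | hr0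
    · rw [edgeMap_zero, edgeMap_len] at h
      injection h with h
      exact absurd h.symm he
    rcases hr.2.eq_or_lt with rfl | hr1
    · rfl
    · rw [edgeMap_len, edgeMap_interior e hr0 hr1] at h
      cases h
  · rw [edgeMap_interior e hs0 hs1, interior_eq_edgeMap_iff] at h
    exact h.2

/-- If both `D - u` and `D - v` are equivalent to effective divisors, where `u ≠ v` are the ends of
the edge `e`, then so is `D - p` for every point `p` of `e`. -/
lemma exists_rational_sub_interior {D : Γ.Divisor} {e : Γ.E} (he : Γ.src e ≠ Γ.tgt e)
    (hu : ∃ f, IsRational f ∧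
      ∀ p, 0 ≤ ((D - Finsupp.single (.vertex (Γ.src e)) 1 : Γ.Divisor) p : ℝ) + ord f p)
    (hv : ∃ f, IsRational f ∧
      ∀ p, 0 ≤ ((D - Finsupp.single (.vertex (Γ.tgt e)) 1 : Γ.Divisor) p : ℝ) + ord f p)
    {t : ℝ} (h0 : 0 < t) (h1 : t < Γ.len e) :
    ∃ f, IsRational f ∧
      ∀ p, 0 ≤ ((D - Finsupp.single (.interior e t h0 h1) 1 : Γ.Divisor) p : ℝ) + ord f p := by
  classical
  -- Adding the constant `c` leaves the divisor of `f` unchanged and makes the two functions agree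
  -- at the point `t`.
  obtain ⟨f₁, hf₁, hD₁⟩ := hu
  obtain ⟨f, hf, hD⟩ := hv
  simp only [Finsupp.coe_sub, Pi.sub_apply, Finsupp.single_apply, Int.cast_sub, Int.cast_ite,
    Int.cast_one, Int.cast_zero, eq_comm (b := (_ : Γ.Point))] at hD₁ hD ⊢
  set c : ℝ := f₁ (Γ.edgeMap e t) - f (Γ.edgeMap e t) with hc
  set f₂ : Γ.Point → ℝ := fun q => f q + c with hf₂d
  have hf₂ : IsRational f₂ := hf.add (isRational_const c)
  have hD₂ : ∀ p, 0 ≤ (D p : ℝ) - (if p = .vertex (Γ.tgt e) then 1 else 0) + ord f₂ p := by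
    intro p
    rw [hf₂d, ord_add_const hf]
    exact hD p
  set h : Γ.Point → ℝ := fun q => max (f₁ q) (f₂ q) with hh
  have hhr : IsRational h := hf₁.max hf₂
  have hle₁ : ∀ q, f₁ q ≤ h q := fun q => le_max_left _ _
  have hle₂ : ∀ q, f₂ q ≤ h q := fun q => le_max_right _ _
  have hind : ∀ (P : Prop) [Decidable P], (0 : ℝ) ≤ if P then 1 else 0 := by
    intro P _; split_ifs <;> norm_num
  have heff : ∀ q, 0 ≤ (D q : ℝ) + ord h q := by
    intro q
    rcases le_total (f₁ q) (f₂ q) with h2 | h2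
    · have := ord_le_ord hf₂ hhr hle₂ (p := q) (max_eq_right h2).symm
      linarith [hD₂ q, hind (q = .vertex (Γ.tgt e))]
    · have := ord_le_ord hf₁ hhr hle₁ (p := q) (max_eq_left h2).symm
      linarith [hD₁ q, hind (q = .vertex (Γ.src e))]
  -- Integrality of orders turns positivity into a whole chip.
  have hone : ∀ q, 0 < (D q : ℝ) + ord h q → 1 ≤ (D q : ℝ) + ord h q := by
    intro q hq
    obtain ⟨k, hk⟩ := hhr.exists_ord_eq q
    rw [hk] at hq ⊢
    have : 0 < D q + k := by exact_mod_cast hq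
    exact_mod_cast this
  have hpl : PLOn (Γ.len e) (fun s => f₁ (Γ.edgeMap e s) + -f₂ (Γ.edgeMap e s)) :=
    (hf₁.plOn e).add (hf₂.plOn e).neg
  have hzero : f₁ (Γ.edgeMap e t) + -f₂ (Γ.edgeMap e t) = 0 := by simp [hf₂d, hc]
  -- `[x, y]` is the maximal interval around `t` on which `f₁ = f₂`; `D + div h` will be shown to
  -- have a chip at both ends.
  obtain ⟨x, hx0, hxt, hxe, hxl⟩ := hpl.exists_left_end h0.le h1.le
  obtain ⟨y, hty, hyL, hye, hyr⟩ := hpl.exists_right_end h0.le h1.le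
  have hx₁₂ : f₁ (Γ.edgeMap e x) = f₂ (Γ.edgeMap e x) := by
    have := hxe x ⟨le_rfl, hxt⟩
    simp only [hzero] at this
    linarith
  have hy₁₂ : f₁ (Γ.edgeMap e y) = f₂ (Γ.edgeMap e y) := by
    have := hye y ⟨hty, le_rfl⟩
    simp only [hzero] at this
    linarith
  -- If `x = 0`, the chip is the one set aside at the source for `f₁`. Otherwise `f₁` and `f₂` have
  -- different left slopes at `x`, and `h`, lying above both, has strictly larger order there than
  -- one of them. The other end is symmetric, with `f₂` and the target.
  have hX : 1 ≤ (D (Γ.edgeMap e x) : ℝ) + ord h (Γ.edgeMap e x) := by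
    have e₁ : f₁ (Γ.edgeMap e x) = h (Γ.edgeMap e x) := by rw [hh]; simp [hx₁₂]
    have e₂ : f₂ (Γ.edgeMap e x) = h (Γ.edgeMap e x) := by rw [hh]; simp [hx₁₂]
    rcases hx0.eq_or_lt with hx0 | hx0
    · subst hx0
      have h2 := ord_le_ord hf₁ hhr hle₁ e₁
      have h3 := hD₁ (Γ.edgeMap e 0)
      rw [if_pos (edgeMap_zero e)] at h3
      linarith
    · apply hone
      have hxL : x < Γ.len e := hxt.trans_lt h1
      have hne : leftSlope f₁ e x ≠ leftSlope f₂ e x := by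
        intro heq
        refine hxl hx0 ?_
        have := (hf₁.leftSlope_spec e hx0 hxL.le).add (hf₂.leftSlope_spec e hx0 hxL.le).neg
        rwa [heq, add_neg_cancel] at this
      have l₁ := leftSlope_le hf₁ hhr hle₁ hx0 hxL.le e₁
      have l₂ := leftSlope_le hf₂ hhr hle₂ hx0 hxL.le e₂
      have r₁ := rightSlope_le hf₁ hhr hle₁ hx0.le hxL e₁
      have r₂ := rightSlope_le hf₂ hhr hle₂ hx0.le hxL e₂
      have d₁ := hD₁ (Γ.edgeMap e x)
      have d₂ := hD₂ (Γ.edgeMap e x)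
      rw [edgeMap_interior e hx0 hxL, if_neg (by simp)] at d₁ d₂
      rw [edgeMap_interior e hx0 hxL]
      simp only [ord] at d₁ d₂ ⊢
      rcases lt_or_gt_of_ne hne with h2 | h2 <;> linarith
  have hY : 1 ≤ (D (Γ.edgeMap e y) : ℝ) + ord h (Γ.edgeMap e y) := by
    have e₁ : f₁ (Γ.edgeMap e y) = h (Γ.edgeMap e y) := by rw [hh]; simp [hy₁₂]
    have e₂ : f₂ (Γ.edgeMap e y) = h (Γ.edgeMap e y) := by rw [hh]; simp [hy₁₂]
    rcases hyL.eq_or_lt with hyL | hyL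
    · have h2 := ord_le_ord hf₂ hhr hle₂ e₂
      have h3 := hD₂ (Γ.edgeMap e y)
      rw [if_pos (by rw [hyL, edgeMap_len])] at h3
      linarith
    · apply hone
      have hy0 : 0 < y := h0.trans_le hty
      have hne : rightSlope f₁ e y ≠ rightSlope f₂ e y := by
        intro heq
        refine hyr hyL ?_
        have := (hf₁.rightSlope_spec e hy0.le hyL).add (hf₂.rightSlope_spec e hy0.le hyL).neg
        rwa [heq, add_neg_cancel] at this
      have l₁ := leftSlope_le hf₁ hhr hle₁ hy0 hyL.le e₁
      have l₂ := leftSlope_le hf₂ hhr hle₂ hy0 hyL.le e₂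
      have r₁ := rightSlope_le hf₁ hhr hle₁ hy0.le hyL e₁
      have r₂ := rightSlope_le hf₂ hhr hle₂ hy0.le hyL e₂
      have d₁ := hD₁ (Γ.edgeMap e y)
      have d₂ := hD₂ (Γ.edgeMap e y)
      rw [edgeMap_interior e hy0 hyL, if_neg (by simp)] at d₁ d₂
      rw [edgeMap_interior e hy0 hyL]
      simp only [ord] at d₁ d₂ ⊢
      rcases lt_or_gt_of_ne hne with h2 | h2 <;> linarith
  rw [← edgeMap_interior e h0 h1]
  have hdirect : 1 ≤ (D (Γ.edgeMap e t) : ℝ) + ord h (Γ.edgeMap e t) →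
      ∃ f, IsRational f ∧
        ∀ p, 0 ≤ (D p : ℝ) - (if p = Γ.edgeMap e t then 1 else 0) + ord f p := by
    intro h2
    refine ⟨h, hhr, fun q => ?_⟩
    split_ifs with hq
    · rw [hq]; linarith
    · linarith [heff q]
  rcases hxt.eq_or_lt with rfl | hxt
  · exact hdirect hX
  rcases hty.eq_or_lt with rfl | hty
  · exact hdirect hY
  obtain ⟨τ, hτ, hτo⟩ := exists_tent e hx0 hxt hty hyL
  refine ⟨fun q => h q + τ q, hhr.add hτ, fun q => ?_⟩
  rw [ord_add hhr hτ]
  have h2 := hτo q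
  have h3 := heff q
  -- The ends must be distinct points, as one chip is known at each. This is where loops are
  -- excluded.
  have hxy : Γ.edgeMap e x ≠ Γ.edgeMap e y := fun h4 => by
    have := edgeMap_injOn he ⟨hx0, by linarith⟩ ⟨by linarith, hyL⟩ h4
    linarith
  by_cases hqx : q = Γ.edgeMap e x
  · rw [if_pos hqx, if_neg (show ¬q = Γ.edgeMap e y from hqx ▸ hxy)] at h2
    rw [← hqx] at hX
    linarith
  · rw [if_neg hqx] at h2
    by_cases hqy : q = Γ.edgeMap e y
    · rw [if_pos hqy] at h2
      rw [← hqy] at hY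
      linarith
    · rw [if_neg hqy] at h2
      linarith

lemma Divisor.deg_add (D D' : Γ.Divisor) : (D + D').deg = D.deg + D'.deg :=
  Finsupp.sum_add_index' (fun _ => rfl) fun _ _ _ => rfl

lemma Divisor.deg_single (p : Γ.Point) (k : ℤ) :
    Divisor.deg (Finsupp.single p k : Γ.Divisor) = k :=
  Finsupp.sum_single_index rfl

/-- The vertices of a graph without loops are rank-determining. -/
theorem vertices_rank_determining (hloop : ∀ e : Γ.E, Γ.src e ≠ Γ.tgt e) (k : ℕ) :
    ∀ D : Γ.Divisor, (∀ E : Γ.Divisor, E.IsEffective → E.deg = k →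
        (∀ p ∈ E.support, ∃ v, p = .vertex v) →
        ∃ f, IsRational f ∧ ∀ p, 0 ≤ ((D - E) p : ℝ) + ord f p) →
      ∀ E : Γ.Divisor, E.IsEffective → E.deg = k →
        ∃ f, IsRational f ∧ ∀ p, 0 ≤ ((D - E) p : ℝ) + ord f p := by
  classical
  -- `D` stays general: the inductive hypothesis is applied to `D - p` for a point `p` of `E`. For
  -- `F` on the vertices, `D - F - p` is then reached from all the `D - F - v` with `v` a vertex.
  induction k with
  | zero =>
    intro D hD E hE hdeg
    refine hD E hE hdeg fun p hp => ?_
    have h0 : ∑ q ∈ E.support, E q = 0 := by simpa [Divisor.deg, Finsupp.sum] using hdeg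
    rw [Finset.sum_eq_zero_iff_of_nonneg fun q _ => hE q] at h0
    exact absurd (h0 p hp) (Finsupp.mem_support_iff.1 hp)
  | succ k ih =>
    intro D hD E hE hdeg
    obtain ⟨p, hp⟩ : ∃ p, E p ≠ 0 := by
      by_contra! h
      have : E = 0 := Finsupp.ext h
      rw [this] at hdeg
      simp [Divisor.deg] at hdeg
      omega
    set E' : Γ.Divisor := E - Finsupp.single p 1 with hE'
    have hEE : E = E' + Finsupp.single p 1 := by simp [hE']
    have hE'eff : E'.IsEffective := by
      intro q
      have h1 := hE q
      simp only [hE', Finsupp.coe_sub, Pi.sub_apply, Finsupp.single_apply]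
      split_ifs with h
      · subst h; omega
      · omega
    have hE'deg : E'.deg = k := by
      rw [hEE, Divisor.deg_add, Divisor.deg_single] at hdeg
      push_cast at hdeg
      omega
    have key := ih (D - Finsupp.single p 1) (fun F hF hFdeg hFs => ?_) E' hE'eff hE'deg
    · rwa [hEE, add_comm, ← sub_sub]
    · have hv : ∀ v : Γ.V, ∃ f, IsRational f ∧
          ∀ q, 0 ≤ (((D - F) - Finsupp.single (.vertex v) 1 : Γ.Divisor) q : ℝ) + ord f q := by
        intro v
        rw [sub_sub]
        refine hD _ ?_ ?_ ?_
        · intro q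
          have := hF q
          simp only [Finsupp.coe_add, Pi.add_apply, Finsupp.single_apply]
          split_ifs <;> omega
        · rw [Divisor.deg_add, Divisor.deg_single, hFdeg]; push_cast; ring
        · intro q hq
          rcases Finset.mem_union.1 (Finsupp.support_add hq) with h | h
          · exact hFs q h
          · exact ⟨v, Finset.mem_singleton.1 (Finsupp.support_single_subset h)⟩
      rw [sub_right_comm]
      cases p with
      | vertex v => exact hv v
      | interior e t h0 h1 => exact exists_rational_sub_interior (hloop e) (hv _) (hv _) h0 h1

end RankDetermining

/-! ### Chip firing on the complete bipartite graph -/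

section Firing

/-- If `x` and `y` are nonnegative with total less than `(a + 1) * (b + 1)`, then some cell of the
`(a + 1) × (b + 1)` grid is covered neither by the last `x k` cells of its row nor by the last `y l`
cells of its column. -/
lemma exists_cell {m n a b : ℕ} (ha : a < m) (hb : b < n) {x : Fin m → ℤ} {y : Fin n → ℤ}
    (hx : ∀ i, 0 ≤ x i) (hy : ∀ j, 0 ≤ y j)
    (hsum : ∑ i, x i + ∑ j, y j < (a + 1) * (b + 1)) :
    ∃ (k : Fin m) (l : Fin n), x k ≤ b - (l : ℕ) ∧ y l ≤ a - (k : ℕ) := by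
  classical
  by_contra! hcon
  set R : Finset (Fin m) := Finset.univ.filter fun k => (k : ℕ) < a + 1
  set C : Finset (Fin n) := Finset.univ.filter fun l => (l : ℕ) < b + 1
  have hR : R.card = a + 1 := by
    simp only [R, Fin.card_filter_val_lt]; omega
  have hC : C.card = b + 1 := by
    simp only [C, Fin.card_filter_val_lt]; omega
  have hcover : R ×ˢ C ⊆ (R ×ˢ C).filter (fun p => (b : ℤ) - (p.2 : ℕ) < x p.1) ∪
      (R ×ˢ C).filter (fun p => (a : ℤ) - (p.1 : ℕ) < y p.2) := by
    intro p hp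
    rw [Finset.mem_union, Finset.mem_filter, Finset.mem_filter]
    by_cases h : (b : ℤ) - (p.2 : ℕ) < x p.1
    · exact Or.inl ⟨hp, h⟩
    · exact Or.inr ⟨hp, hcon _ _ (not_lt.1 h)⟩
  -- A line of the grid has at most `z` cells among its last `z`; the map `l ↦ c - l` numbers them
  -- from the end.
  have count : ∀ {N c : ℕ} (z : ℤ), 0 ≤ z →
      ((Finset.card (Finset.filter (fun l : Fin N => (c : ℤ) - (l : ℕ) < z)
        (Finset.filter (fun l : Fin N => (l : ℕ) < c + 1) Finset.univ)) : ℕ) : ℤ) ≤ z := by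
    intro N c z hz
    have : Finset.card (Finset.filter (fun l : Fin N => (c : ℤ) - (l : ℕ) < z)
        (Finset.filter (fun l : Fin N => (l : ℕ) < c + 1) Finset.univ)) ≤
          (Finset.range z.toNat).card := by
      refine Finset.card_le_card_of_injOn (fun l => c - (l : ℕ)) ?_ ?_
      · intro l hl
        rw [Finset.mem_coe, Finset.mem_filter, Finset.mem_filter] at hl
        rw [Finset.coe_range, mem_Iio]
        dsimp only
        omega
      · intro l hl l' hl' h
        rw [Finset.mem_coe, Finset.mem_filter, Finset.mem_filter] at hl hl'
        have h : c - (l : ℕ) = c - (l' : ℕ) := h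
        exact Fin.ext (by omega)
    rw [Finset.card_range] at this
    omega
  have h1 : (((R ×ˢ C).filter (fun p => (b : ℤ) - (p.2 : ℕ) < x p.1)).card : ℤ) ≤ ∑ i, x i := by
    rw [Finset.card_filter, Finset.sum_product]
    push_cast
    refine (Finset.sum_le_sum (g := x) fun k _ => ?_).trans
      (Finset.sum_le_sum_of_subset_of_nonneg (Finset.subset_univ R) fun i _ _ => hx i)
    have := count (N := n) (c := b) (x k) (hx k)
    rw [Finset.card_filter] at this
    push_cast at this
    exact this
  have h2 : (((R ×ˢ C).filter (fun p => (a : ℤ) - (p.1 : ℕ) < y p.2)).card : ℤ) ≤ ∑ j, y j := by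
    rw [Finset.card_filter, Finset.sum_product_right]
    push_cast
    refine (Finset.sum_le_sum (g := y) fun k _ => ?_).trans
      (Finset.sum_le_sum_of_subset_of_nonneg (Finset.subset_univ C) fun i _ _ => hy i)
    have := count (N := m) (c := a) (y k) (hy k)
    rw [Finset.card_filter] at this
    push_cast at this
    exact this
  have h3 := (Finset.card_le_card hcover).trans (Finset.card_union_le _ _)
  rw [Finset.card_product, hR, hC] at h3
  have h4 : ((a + 1) * (b + 1) : ℤ) ≤ ∑ i, x i + ∑ j, y j := by
    have : (((a + 1) * (b + 1) : ℕ) : ℤ) ≤ _ := Nat.cast_le.2 h3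
    push_cast at this
    linarith
  linarith

/-- The chip-firing statement for balanced antitone data. -/
lemma exists_firing_of_antitone {m n a b : ℕ} (ha : a < m) (hb : b < n) {x : Fin m → ℤ}
    {y : Fin n → ℤ} (hx : ∀ i, 0 ≤ x i) (hy : ∀ j, 0 ≤ y j) (hxa : Antitone x) (hya : Antitone y)
    (hxb : ∀ i i', x i ≤ x i' + n) (hyb : ∀ j j', y j ≤ y j' + m)
    (hsum : ∑ i, x i + ∑ j, y j < (a + 1) * (b + 1)) :
    ∃ (p : Fin m → ℤ) (q : Fin n → ℤ),
      (∀ i, x i ≤ b + ∑ j, (q j - p i)) ∧ ∀ j, y j ≤ a + ∑ i, (p i - q j) := by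
  obtain ⟨k, l, hk, hl⟩ := exists_cell ha hb hx hy hsum
  have hsumlt : ∀ {N : ℕ} (c : Fin N), ∑ j : Fin N, (if (j : ℕ) < c then (-1 : ℤ) else 0) = -c := by
    intro N c
    rw [Finset.sum_ite, Finset.sum_const, Finset.sum_const_zero, Fin.card_filter_val_lt,
      min_eq_right c.2.le]
    simp
  -- Lowering the first `k` and first `l` values by one costs `v_i` exactly `l` chips if `i ≥ k`,
  -- where `x i ≤ x k ≤ b - l` by monotonicity. If `i < k` it gains `n - l`, and balance gives `x i
  -- ≤ x k + n`. The other side is symmetric.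
  refine ⟨fun i => if (i : ℕ) < k then -1 else 0, fun j => if (j : ℕ) < l then -1 else 0,
    fun i => ?_, fun j => ?_⟩
  · rw [Finset.sum_sub_distrib, hsumlt l, Finset.sum_const, Finset.card_univ, Fintype.card_fin,
      nsmul_eq_mul]
    dsimp only
    split_ifs with h
    · have := hxb i k
      linarith
    · have := hxa (show k ≤ i from not_lt.1 h)
      linarith
  · rw [Finset.sum_sub_distrib, hsumlt k, Finset.sum_const, Finset.card_univ, Fintype.card_fin,
      nsmul_eq_mul]
    dsimp only
    split_ifs with h
    · have := hyb j l
      linarith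
    · have := hya (show l ≤ j from not_lt.1 h)
      linarith

lemma exists_antitone_perm {N : ℕ} (x : Fin N → ℤ) :
    ∃ σ : Equiv.Perm (Fin N), Antitone (x ∘ σ) := by
  refine ⟨Tuple.sort (fun i => -x i), fun i j hij => ?_⟩
  have := Tuple.monotone_sort (fun i => -x i) hij
  simpa using this

/-- The chip-firing statement for balanced data. -/
lemma exists_firing_of_balanced {m n a b : ℕ} (ha : a < m) (hb : b < n) {x : Fin m → ℤ}
    {y : Fin n → ℤ} (hx : ∀ i, 0 ≤ x i) (hy : ∀ j, 0 ≤ y j)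
    (hxb : ∀ i i', x i ≤ x i' + n) (hyb : ∀ j j', y j ≤ y j' + m)
    (hsum : ∑ i, x i + ∑ j, y j < (a + 1) * (b + 1)) :
    ∃ (p : Fin m → ℤ) (q : Fin n → ℤ),
      (∀ i, x i ≤ b + ∑ j, (q j - p i)) ∧ ∀ j, y j ≤ a + ∑ i, (p i - q j) := by
  obtain ⟨σ, hσ⟩ := exists_antitone_perm x
  obtain ⟨π, hπ⟩ := exists_antitone_perm y
  obtain ⟨p, q, hp, hq⟩ := exists_firing_of_antitone ha hb (fun i => hx (σ i)) (fun j => hy (π j))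
    hσ hπ (fun i i' => hxb _ _) (fun j j' => hyb _ _)
    (by rwa [Equiv.sum_comp σ x, Equiv.sum_comp π y])
  refine ⟨p ∘ σ.symm, q ∘ π.symm, fun i => ?_, fun j => ?_⟩
  · have := hp (σ.symm i)
    rw [← Equiv.sum_comp π.symm] at this
    simpa using this
  · have := hq (π.symm j)
    rw [← Equiv.sum_comp σ.symm] at this
    simpa using this

/-- Any nonnegative family of integers can be balanced modulo `N`, without changing the sum. -/
lemma exists_balanced {ι : Type*} [Fintype ι] [DecidableEq ι] {N : ℤ} (hN : 0 < N) (x : ι → ℤ)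
    (hx : ∀ i, 0 ≤ x i) : ∃ r : ι → ℤ, ∑ i, r i = 0 ∧ (∀ i, 0 ≤ x i + N * r i) ∧
      ∀ i i', x i + N * r i ≤ x i' + N * r i' + N := by
  induction hk : (∑ i, x i ^ 2).toNat using Nat.strong_induction_on generalizing x with
  | _ k ih =>
  by_cases hbal : ∀ i i', x i ≤ x i' + N
  · exact ⟨0, by simp, by simpa using hx, by simpa using hbal⟩
  push Not at hbal
  obtain ⟨i, j, hij⟩ := hbal
  have hne : i ≠ j := by rintro rfl; linarith
  set d : ι → ℤ := fun c => (if c = i then -1 else 0) + (if c = j then 1 else 0) with hd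
  have hdsum : ∑ c, d c = 0 := by simp [hd, Finset.sum_add_distrib]
  -- Moving `N` from `x i` to `x j` when `x i > x j + N` keeps both nonnegative and lowers the sum
  -- of squares by `2 * N * (x i - x j - N)`.
  have hsq : ∑ c, (x c + N * d c) ^ 2 < ∑ c, x c ^ 2 := by
    have h1 : ∀ c, (x c + N * d c) ^ 2 = x c ^ 2 +
        ((if c = i then N ^ 2 - 2 * N * x c else 0) +
          (if c = j then N ^ 2 + 2 * N * x c else 0)) := by
      intro c
      by_cases hci : c = i
      · have hcj : c ≠ j := fun h => hne (hci ▸ h)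
        simp only [hd, hci, if_true, if_neg (hci ▸ hcj)]; ring
      · by_cases hcj : c = j
        · simp only [hd, if_neg hci, if_pos hcj]; ring
        · simp only [hd, if_neg hci, if_neg hcj]; ring
    simp only [h1, Finset.sum_add_distrib, Finset.sum_ite_eq', Finset.mem_univ, if_true]
    nlinarith
  have hnn : 0 ≤ ∑ c, (x c + N * d c) ^ 2 := Finset.sum_nonneg fun c _ => sq_nonneg _
  obtain ⟨r, hr0, hr1, hr2⟩ := ih _ (by omega) (fun c => x c + N * d c) (fun c => by
    have h1 := hx c
    have h2 := hx j
    by_cases hci : c = i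
    · subst hci
      simp only [hd, if_true, if_neg hne]
      linarith
    · simp only [hd, if_neg hci]
      split_ifs <;> linarith) rfl
  refine ⟨fun c => d c + r c, by rw [Finset.sum_add_distrib, hdsum, hr0, add_zero], fun c => ?_,
    fun c c' => ?_⟩
  · linarith [hr1 c]
  · linarith [hr2 c c']

/-- Every effective divisor of degree less than `(a + 1) * (b + 1)` on the vertices of `K_{m,n}` can
be reached from the divisor with coefficients `b` on one side and `a` on the other by chip
firing. -/
theorem exists_firing {m n a b : ℕ} (ha : a < m) (hb : b < n) {x : Fin m → ℤ}
    {y : Fin n → ℤ} (hx : ∀ i, 0 ≤ x i) (hy : ∀ j, 0 ≤ y j)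
    (hsum : ∑ i, x i + ∑ j, y j < (a + 1) * (b + 1)) :
    ∃ (p : Fin m → ℤ) (q : Fin n → ℤ),
      (∀ i, x i ≤ b + ∑ j, (q j - p i)) ∧ ∀ j, y j ≤ a + ∑ i, (p i - q j) := by
  obtain ⟨r, hr0, hr1, hr2⟩ := exists_balanced (N := n) (by omega) x hx
  obtain ⟨s, hs0, hs1, hs2⟩ := exists_balanced (N := m) (by omega) y hy
  obtain ⟨p, q, hp, hq⟩ := exists_firing_of_balanced ha hb hr1 hs1 hr2 hs2 (by
    simpa [Finset.sum_add_distrib, ← Finset.mul_sum, hr0, hs0] using hsum)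
  -- Adding `r` to `p` changes the `i`-th coefficient on the first side by `-n * r i` and nothing on
  -- the second, because `r` sums to zero; likewise for `s`.
  refine ⟨fun i => p i + r i, fun j => q j + s j, fun i => ?_, fun j => ?_⟩
  · have := hp i
    simp only [Finset.sum_sub_distrib, Finset.sum_add_distrib, hs0, Finset.sum_const,
      Finset.card_univ, Fintype.card_fin, nsmul_eq_mul] at this ⊢
    linarith
  · have := hq j
    simp only [Finset.sum_sub_distrib, Finset.sum_add_distrib, hr0, Finset.sum_const,
      Finset.card_univ, Fintype.card_fin, nsmul_eq_mul] at this ⊢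
    linarith

end Firing

/-- Nonnegative order at an interior point says that the slope does not drop there, that is, `f` is
convex along the edge. -/
lemma IsRational.le_chord {Γ : MetricGraph} {f : Γ.Point → ℝ} (hf : IsRational f) {e : Γ.E}
    (hconv : ∀ t h0 h1, 0 ≤ ord f (.interior e t h0 h1)) {t : ℝ} (h0 : 0 ≤ t)
    (h1 : t ≤ Γ.len e) : Γ.len e * f (Γ.edgeMap e t) ≤
      Γ.len e * f (Γ.edgeMap e 0) + (f (Γ.edgeMap e (Γ.len e)) - f (Γ.edgeMap e 0)) * t := by
  refine (hf.plOn e).le_chord (fun s hs0 hs1 l r hl hr => ?_) h0 h1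
  have := hconv s hs0 hs1
  simp only [ord] at this
  rw [rightSlope_eq hr, leftSlope_eq hl] at this
  linarith

/-! ### The two bounds for the rank on `K_{m,n}` -/

section Bipartite

variable {m n : ℕ}

lemma completeBipartite_loopless (e : (completeBipartite m n).E) :
    (completeBipartite m n).src e ≠ (completeBipartite m n).tgt e := Sum.inl_ne_inr

lemma edgeMap_zero_bipartite (i : Fin m) (j : Fin n) :
    (completeBipartite m n).edgeMap (i, j) 0 = vPoint m n i := edgeMap_zero _

lemma edgeMap_one_bipartite (i : Fin m) (j : Fin n) :
    (completeBipartite m n).edgeMap (i, j) 1 = wPoint m n j :=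
  edgeMap_len (Γ := completeBipartite m n) (i, j)

lemma ord_vPoint (f : (completeBipartite m n).Point → ℝ) (i : Fin m) :
    ord f (vPoint m n i) = ∑ j : Fin n, rightSlope (Γ := completeBipartite m n) f (i, j) 0 := by
  classical
  refine (congrArg₂ (· + ·) ?_ (Finset.sum_eq_zero fun e he => ?_)).trans (add_zero _)
  · refine Finset.sum_nbij' (fun e : Fin m × Fin n => e.2) (fun j => (i, j)) (fun _ _ =>
      Finset.mem_univ _) (fun j _ => Finset.mem_filter.2 ⟨Finset.mem_univ _, rfl⟩)
      (fun e he => ?_) (fun _ _ => rfl) (fun e he => ?_)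
    · exact Prod.ext (Sum.inl_injective (Finset.mem_filter.1 he).2).symm rfl
    · rw [← Sum.inl_injective (Finset.mem_filter.1 he).2]
      rfl
  · exact absurd (Finset.mem_filter.1 he).2 Sum.inr_ne_inl

lemma ord_wPoint (f : (completeBipartite m n).Point → ℝ) (j : Fin n) :
    ord f (wPoint m n j) = ∑ i : Fin m, -leftSlope (Γ := completeBipartite m n) f (i, j) 1 := by
  classical
  refine (congrArg₂ (· + ·) (Finset.sum_eq_zero fun e he => ?_) ?_).trans (zero_add _)
  · exact absurd (Finset.mem_filter.1 he).2 Sum.inl_ne_inr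
  · refine Finset.sum_nbij' (fun e : Fin m × Fin n => e.1) (fun i => (i, j)) (fun _ _ =>
      Finset.mem_univ _) (fun j _ => Finset.mem_filter.2 ⟨Finset.mem_univ _, rfl⟩)
      (fun e he => ?_) (fun _ _ => rfl) (fun e he => ?_)
    · exact Prod.ext rfl (Sum.inr_injective (Finset.mem_filter.1 he).2).symm
    · rw [← Sum.inr_injective (Finset.mem_filter.1 he).2]
      rfl

lemma vPoint_injective : Function.Injective (vPoint m n) := fun i i' h => by
  injection h with h; exact Sum.inl_injective h

lemma wPoint_injective : Function.Injective (wPoint m n) := fun i i' h => by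
  injection h with h; exact Sum.inr_injective h

lemma vPoint_ne_wPoint (i : Fin m) (j : Fin n) : vPoint m n i ≠ wPoint m n j := fun h => by
  injection h with h; exact Sum.inl_ne_inr h

lemma bipartiteDivisor_vPoint (a b : ℤ) (i : Fin m) :
    bipartiteDivisor m n a b (vPoint m n i) = b := by
  classical
  simp [bipartiteDivisor, Finsupp.single_apply,
    vPoint_injective.eq_iff, (vPoint_ne_wPoint _ _).symm]

lemma bipartiteDivisor_wPoint (a b : ℤ) (j : Fin n) :
    bipartiteDivisor m n a b (wPoint m n j) = a := by
  classical
  simp [bipartiteDivisor, Finsupp.single_apply,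
    wPoint_injective.eq_iff, vPoint_ne_wPoint]

lemma bipartiteDivisor_interior (a b : ℤ) (e : (completeBipartite m n).E) (t : ℝ) (h0 h1) :
    bipartiteDivisor m n a b (.interior e t h0 h1) = 0 := by
  classical
  simp [bipartiteDivisor, vPoint, wPoint]

lemma Divisor.deg_sum {Γ : MetricGraph} {ι : Type*} (s : Finset ι) (D : ι → Γ.Divisor) :
    Divisor.deg (∑ i ∈ s, D i) = ∑ i ∈ s, (D i).deg :=
  map_sum (AddMonoidHom.mk' (Divisor.deg (Γ := Γ)) Divisor.deg_add) D s

lemma deg_bipartiteDivisor (m n : ℕ) (a b : ℤ) :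
    (bipartiteDivisor m n a b).deg = a * n + b * m := by
  rw [bipartiteDivisor, Divisor.deg_add, Divisor.deg_sum, Divisor.deg_sum]
  simp only [Divisor.deg_single]
  simp
  ring

/-- The edgewise affine function with prescribed integer values at the vertices. -/
lemma exists_rational_of_values (p : Fin m → ℤ) (q : Fin n → ℤ) :
    ∃ f : (completeBipartite m n).Point → ℝ, IsRational f ∧
      (∀ i, ord f (vPoint m n i) = ∑ j, (q j - p i : ℤ)) ∧
      (∀ j, ord f (wPoint m n j) = ∑ i, (p i - q j : ℤ)) ∧
      ∀ e t h0 h1, ord f (.interior e t h0 h1) = 0 := by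
  let f : (completeBipartite m n).Point → ℝ := fun x => match x with
    | .vertex (.inl i) => p i
    | .vertex (.inr j) => q j
    | .interior e t _ _ => p e.1 + (q e.2 - p e.1 : ℤ) * t
  have hfe : ∀ (e : Fin m × Fin n) (t : ℝ), 0 ≤ t → t ≤ 1 →
      f ((completeBipartite m n).edgeMap e t) = p e.1 + (q e.2 - p e.1 : ℤ) * t := by
    intro e t h0 h1
    rcases h0.eq_or_lt with rfl | h0
    · rw [edgeMap_zero_bipartite e.1 e.2]; simp [vPoint, f]
    rcases h1.eq_or_lt with rfl | h1
    · rw [edgeMap_one_bipartite e.1 e.2]; simp [wPoint, f]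
    · rw [edgeMap_interior (Γ := completeBipartite m n) e h0 h1]
  have hf : IsRational f := isRational_iff_plOn.2 fun e => (PLOn.affine _ _ _).congr (hfe e)
  have hr : ∀ (e : Fin m × Fin n) (t : ℝ), 0 ≤ t → t < 1 →
      rightSlope (Γ := completeBipartite m n) f e t = (q e.2 - p e.1 : ℤ) := by
    intro e t h0 h1
    refine rightSlope_eq ?_
    filter_upwards [Ioo_mem_nhdsGT h1] with u hu
    rw [hfe e u (h0.trans hu.1.le) hu.2.le, hfe e t h0 h1.le]; ring
  have hl : ∀ (e : Fin m × Fin n) (t : ℝ), 0 < t → t ≤ 1 →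
      leftSlope (Γ := completeBipartite m n) f e t = (q e.2 - p e.1 : ℤ) := by
    intro e t h0 h1
    refine leftSlope_eq ?_
    filter_upwards [Ioo_mem_nhdsLT h0] with u hu
    rw [hfe e u hu.1.le (hu.2.le.trans h1), hfe e t h0.le h1]; ring
  refine ⟨f, hf, fun i => ?_, fun j => ?_, fun e t h0 h1 => ?_⟩
  · rw [ord_vPoint, Int.cast_sum]
    exact Finset.sum_congr rfl fun j _ => hr (i, j) 0 le_rfl one_pos
  · rw [ord_wPoint, Int.cast_sum]
    refine Finset.sum_congr rfl fun i _ => ?_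
    rw [hl (i, j) 1 one_pos le_rfl]; push_cast; ring
  · simp only [ord]
    rw [hr e t h0.le h1, hl e t h0 h1.le, add_neg_cancel]

lemma deg_eq_of_support {E : (completeBipartite m n).Divisor}
    (hE : ∀ p ∈ E.support, ∃ v, p = .vertex v) :
    E.deg = ∑ i, E (vPoint m n i) + ∑ j, E (wPoint m n j) := by
  classical
  have hsub : E.support ⊆ (Finset.univ : Finset (completeBipartite m n).V).image
      Point.vertex := by
    intro p hp
    obtain ⟨v, rfl⟩ := hE p hp
    exact Finset.mem_image_of_mem _ (Finset.mem_univ v)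
  rw [Divisor.deg, Finsupp.sum_of_support_subset _ hsub _ (fun _ _ => rfl),
    Finset.sum_image (fun v _ w _ h => by injection h)]
  exact Fintype.sum_sum_type fun v : Fin m ⊕ Fin n => E (.vertex v)

/-- The lower bound for the rank. -/
theorem exists_rational_sub_effective {a b : ℕ} (ha : a < m) (hb : b < n)
    {E : (completeBipartite m n).Divisor} (hE : E.IsEffective)
    (hdeg : E.deg = (a + 1) * (b + 1) - 1) :
    ∃ f, IsRational f ∧ ∀ p, 0 ≤ ((bipartiteDivisor m n a b - E) p : ℝ) + ord f p := by
  obtain ⟨k, hk⟩ : ∃ k : ℕ, ((a + 1) * (b + 1) - 1 : ℤ) = k :=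
    ⟨a * b + a + b, by push_cast; ring⟩
  refine vertices_rank_determining completeBipartite_loopless k _ (fun F hF hFdeg hFs => ?_) E hE
    (hdeg.trans hk)
  rw [deg_eq_of_support hFs, ← hk] at hFdeg
  obtain ⟨p, q, hp, hq⟩ := exists_firing ha hb (fun i => hF (vPoint m n i))
    (fun j => hF (wPoint m n j)) (by linarith)
  obtain ⟨f, hf, hv, hw, hi⟩ := exists_rational_of_values p q
  refine ⟨f, hf, fun x => ?_⟩
  cases x with
  | vertex v =>
    cases v with
    | inl i =>
      have h1 : 0 ≤ (bipartiteDivisor m n a b - F) (vPoint m n i) + ∑ j, (q j - p i) := by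
        rw [Finsupp.coe_sub, Pi.sub_apply, bipartiteDivisor_vPoint]
        linarith [hp i]
      have h2 := hv i
      simp only [vPoint] at h1 h2
      rw [h2]
      exact_mod_cast h1
    | inr j =>
      have h1 : 0 ≤ (bipartiteDivisor m n a b - F) (wPoint m n j) + ∑ i, (p i - q j) := by
        rw [Finsupp.coe_sub, Pi.sub_apply, bipartiteDivisor_wPoint]
        linarith [hq j]
      have h2 := hw j
      simp only [wPoint] at h1 h2
      rw [h2]
      exact_mod_cast h1
  | interior e t h0 h1 =>
    have : F (.interior e t h0 h1) = 0 := by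
      by_contra h
      obtain ⟨v, hv⟩ := hFs _ (Finsupp.mem_support_iff.2 h)
      cases hv
    rw [hi, Finsupp.coe_sub, Pi.sub_apply, bipartiteDivisor_interior, this]
    simp

/-- An obstruction to being equivalent to an effective divisor: a divisor on `K_{m,n}` which is
negative at more than `a` of the `v_i`, at most `b < n` at the others, at most `a` at the `w_j`, and
zero elsewhere. -/
theorem not_exists_rational {a b : ℕ} (ha : a < m) (hb : b < n)
    {D : (completeBipartite m n).Divisor}
    (hneg : ∀ i : Fin m, (i : ℕ) ≤ a → D (vPoint m n i) < 0)
    (hv : ∀ i, D (vPoint m n i) ≤ b) (hw : ∀ j, D (wPoint m n j) ≤ a)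
    (hint : ∀ e t h0 h1, D (.interior e t h0 h1) = 0) :
    ¬ ∃ f, IsRational f ∧ ∀ p, 0 ≤ (D p : ℝ) + ord f p := by
  classical
  rintro ⟨f, hf, hD⟩
  have hconv : ∀ e t h0 h1, 0 ≤ ord f (.interior e t h0 h1) := by
    intro e t h0 h1
    simpa [hint] using hD (.interior e t h0 h1)
  have chord : ∀ (i : Fin m) (j : Fin n) (t : ℝ), 0 ≤ t → t ≤ 1 →
      f ((completeBipartite m n).edgeMap (i, j) t) ≤
        f (vPoint m n i) + (f (wPoint m n j) - f (vPoint m n i)) * t := by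
    intro i j t h0 h1
    have := hf.le_chord (e := (i, j)) (hconv _) h0 h1
    change 1 * _ ≤ 1 * _ + (f ((completeBipartite m n).edgeMap (i, j) 1) - _) * t at this
    rw [one_mul, one_mul, edgeMap_zero_bipartite, edgeMap_one_bipartite] at this
    exact this
  have hright : ∀ (i : Fin m) (j : Fin n), rightSlope (Γ := completeBipartite m n) f (i, j) 0 ≤
      f (wPoint m n j) - f (vPoint m n i) := by
    intro i j
    have h1 := (hf.rightSlope_spec (i, j) le_rfl one_pos).neg
    have h2 := h1.le_of_frequently (r := -(f (wPoint m n j) - f (vPoint m n i)))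
      (Eventually.frequently ?_)
    · linarith
    · filter_upwards [Ioo_mem_nhdsGT one_pos] with u hu
      have := chord i j u hu.1.le hu.2.le
      rw [edgeMap_zero_bipartite]
      linarith
  have hleft : ∀ (i : Fin m) (j : Fin n), -leftSlope (Γ := completeBipartite m n) f (i, j) 1 ≤
      f (vPoint m n i) - f (wPoint m n j) := by
    intro i j
    have h1 := (hf.leftSlope_spec (i, j) one_pos le_rfl).neg
    have h2 := h1.le_of_frequently (r := -(f (wPoint m n j) - f (vPoint m n i)))
      (Eventually.frequently ?_)
    · linarith
    · filter_upwards [Ioo_mem_nhdsLT one_pos] with u hu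
      have := chord i j u hu.1.le hu.2.le
      rw [edgeMap_one_bipartite]
      linarith
  have : Nonempty (Fin m ⊕ Fin n) := ⟨.inl ⟨a, ha⟩⟩
  -- Convexity bounds the outgoing slopes at a vertex by differences of vertex values, so only the
  -- maximum over the vertices matters.
  obtain ⟨v₀, hv₀⟩ := Finite.exists_max fun v : Fin m ⊕ Fin n =>
    f (Point.vertex (Γ := completeBipartite m n) v)
  set M := f (Point.vertex (Γ := completeBipartite m n) v₀) with hM
  have hvM : ∀ i, f (vPoint m n i) ≤ M := fun i => hv₀ (.inl i)
  have hwM : ∀ j, f (wPoint m n j) ≤ M := fun j => hv₀ (.inr j)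
  set SV : Finset (Fin m) := Finset.univ.filter fun i => f (vPoint m n i) = M with hSV
  set SW : Finset (Fin n) := Finset.univ.filter fun j => f (wPoint m n j) = M with hSW
  -- Along an edge from a maximal vertex to one that is not maximal, the outgoing slope is negative,
  -- hence at most `-1` by integrality.
  have ord_v : ∀ i ∈ SV, ord f (vPoint m n i) ≤ -((n : ℝ) - SW.card) := by
    intro i hi
    have hi : f (vPoint m n i) = M := (Finset.mem_filter.1 hi).2
    have h1 : ∀ j, rightSlope (Γ := completeBipartite m n) f (i, j) 0 ≤
        -1 + if j ∈ SW then 1 else 0 := by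
      intro j
      have h2 := hright i j
      have h3 := hwM j
      split_ifs with hj
      · linarith
      · obtain ⟨s, hs⟩ := hf.exists_rightSlope_eq (i, j) le_rfl one_pos
        have h4 : f (wPoint m n j) ≠ M := fun h => hj (Finset.mem_filter.2 ⟨Finset.mem_univ _, h⟩)
        have h5 := lt_of_le_of_ne h3 h4
        rw [hs] at h2 ⊢
        have h6 : (s : ℝ) < 0 := by linarith
        have h7 : s < 0 := by exact_mod_cast h6
        have h8 : s ≤ -1 := by omega
        have h9 : (s : ℝ) ≤ -1 := by exact_mod_cast h8
        linarith
    rw [ord_vPoint]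
    refine (Finset.sum_le_sum fun j _ => h1 j).trans (le_of_eq ?_)
    simp [Finset.sum_add_distrib, sub_eq_neg_add]
  have ord_w : ∀ j ∈ SW, ord f (wPoint m n j) ≤ -((m : ℝ) - SV.card) := by
    intro j hj
    have hj : f (wPoint m n j) = M := (Finset.mem_filter.1 hj).2
    have h1 : ∀ i, -leftSlope (Γ := completeBipartite m n) f (i, j) 1 ≤
        -1 + if i ∈ SV then 1 else 0 := by
      intro i
      have h2 := hleft i j
      have h3 := hvM i
      split_ifs with hi
      · linarith
      · obtain ⟨s, hs⟩ := hf.exists_leftSlope_eq (i, j) one_pos le_rfl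
        have hs : leftSlope (Γ := completeBipartite m n) f (i, j) 1 = s := hs
        have h4 : f (vPoint m n i) ≠ M := fun h => hi (Finset.mem_filter.2 ⟨Finset.mem_univ _, h⟩)
        have h5 := lt_of_le_of_ne h3 h4
        rw [hs] at h2 ⊢
        have h6 : (0 : ℝ) < s := by linarith
        have h7 : 0 < s := by exact_mod_cast h6
        have h8 : 1 ≤ s := by omega
        have h9 : (1 : ℝ) ≤ s := by exact_mod_cast h8
        linarith
    rw [ord_wPoint]
    refine (Finset.sum_le_sum fun i _ => h1 i).trans (le_of_eq ?_)
    simp [Finset.sum_add_distrib, sub_eq_neg_add]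
  have hSWn : (SW.card : ℝ) ≤ n := by exact_mod_cast card_finset_fin_le SW
  -- A maximal vertex has nonpositive order, so `D` cannot be negative there.
  have hSV_big : ∀ i ∈ SV, a < (i : ℕ) := by
    intro i hi
    by_contra! h
    have h1 := ord_v i hi
    have h2 := hD (vPoint m n i)
    have h3 : (D (vPoint m n i) : ℝ) < 0 := by exact_mod_cast hneg i h
    linarith
  have hSVcard : SV.card + (a + 1) ≤ m := by
    have h1 : SV ⊆ Finset.univ.filter fun i : Fin m => ¬ (i : ℕ) < a + 1 := by
      intro i hi
      have := hSV_big i hi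
      exact Finset.mem_filter.2 ⟨Finset.mem_univ _, by omega⟩
    have h2 := Finset.card_le_card h1
    have h3 := Finset.card_filter_add_card_filter_not (s := Finset.univ)
      (fun i : Fin m => (i : ℕ) < a + 1)
    rw [Fin.card_filter_val_lt, Finset.card_univ, Fintype.card_fin] at h3
    omega
  -- At least `a + 1` of the `v_i` are not maximal, so a maximal `w_j` would lose at least `a + 1`
  -- chips and has at most `a`.
  have hSWe : SW = ∅ := by
    by_contra h
    obtain ⟨j, hj⟩ := Finset.nonempty_iff_ne_empty.2 h
    have h1 := ord_w j hj
    have h2 := hD (wPoint m n j)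
    have h3 : (D (wPoint m n j) : ℝ) ≤ a := by exact_mod_cast hw j
    have h4 : (SV.card + (a + 1) : ℝ) ≤ m := by exact_mod_cast hSVcard
    linarith
  -- Some `v_i` is therefore maximal and no `w_j` is: it loses `n` chips and has at most `b < n`.
  cases v₀ with
  | inl i =>
    have h1 := ord_v i (Finset.mem_filter.2 ⟨Finset.mem_univ _, rfl⟩)
    have h2 := hD (vPoint m n i)
    have h3 : (D (vPoint m n i) : ℝ) ≤ b := by exact_mod_cast hv i
    have h4 : (b : ℝ) < n := by exact_mod_cast hb
    rw [hSWe, Finset.card_empty] at h1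
    push_cast at h1
    linarith
  | inr j =>
    have : j ∈ SW := Finset.mem_filter.2 ⟨Finset.mem_univ _, rfl⟩
    rw [hSWe] at this
    exact absurd this (Finset.notMem_empty j)

theorem hasRank_bipartiteDivisor {a b : ℕ} (ha : a < m) (hb : b < n) :
    (bipartiteDivisor m n a b).HasRank ((a + 1) * (b + 1) - 1) := by
  classical
  constructor
  · intro E hE hdeg
    rw [exists_linEquiv_effective_iff]
    exact exists_rational_sub_effective ha hb hE hdeg
  · intro k hk
    by_contra! hlt
    -- Every `k ≥ (a + 1) * (b + 1)` has to be excluded; the surplus `c` goes to the first vertex,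
    -- where the difference is negative anyway.
    set c : ℤ := k - (a + 1) * (b + 1) with hc
    have hc0 : 0 ≤ c := by omega
    set o : Fin m := ⟨0, by omega⟩
    set E : (completeBipartite m n).Divisor :=
      (∑ i : Fin m, Finsupp.single (vPoint m n i) (if (i : ℕ) < a + 1 then (b + 1 : ℤ) else 0)) +
        Finsupp.single (vPoint m n o) c with hEdef
    have hEv : ∀ i, E (vPoint m n i) =
        (if (i : ℕ) < a + 1 then (b + 1 : ℤ) else 0) + if o = i then c else 0 := by
      intro i
      simp [hEdef, Finsupp.single_apply, vPoint_injective.eq_iff]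
    have hEw : ∀ j, E (wPoint m n j) = 0 := by
      intro j
      simp [hEdef, vPoint_ne_wPoint]
    have hEi : ∀ e t h0 h1, E (.interior e t h0 h1) = 0 := by
      intro e t h0 h1
      simp [hEdef, vPoint]
    have hEv0 : ∀ i, 0 ≤ E (vPoint m n i) := by
      intro i
      rw [hEv]
      split_ifs <;> omega
    have hE : E.IsEffective := by
      intro p
      cases p with
      | vertex v =>
        cases v with
        | inl i => exact hEv0 i
        | inr j => exact (hEw j).ge
      | interior e t h0 h1 => exact (hEi e t h0 h1).ge
    have hdeg : E.deg = k := by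
      rw [hEdef, Divisor.deg_add, Divisor.deg_sum]
      simp only [Divisor.deg_single]
      rw [Finset.sum_ite, Finset.sum_const_zero, Finset.sum_const, Fin.card_filter_val_lt,
        min_eq_right (by omega), nsmul_eq_mul, hc]
      push_cast
      ring
    have := exists_linEquiv_effective_iff.1 (hk E hE hdeg)
    refine not_exists_rational ha hb (fun i hi => ?_) (fun i => ?_) (fun j => ?_)
      (fun e t h0 h1 => ?_) this
    · rw [Finsupp.coe_sub, Pi.sub_apply, bipartiteDivisor_vPoint, hEv, if_pos (by omega)]
      split_ifs <;> omega
    · rw [Finsupp.coe_sub, Pi.sub_apply, bipartiteDivisor_vPoint]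
      linarith [hEv0 i]
    · rw [Finsupp.coe_sub, Pi.sub_apply, bipartiteDivisor_wPoint, hEw, sub_zero]
    · rw [Finsupp.coe_sub, Pi.sub_apply, bipartiteDivisor_interior, hEi, sub_zero]

end Bipartite

end MetricGraph

theorem theorem4p1 (m n : ℕ) (a b : ℤ) (ha₀ : 0 ≤ a) (ha : a ≤ (m : ℤ) - 1)
    (hb₀ : 0 ≤ b) (hb : b ≤ (n : ℤ) - 1) :
    (MetricGraph.bipartiteDivisor m n a b).deg = a * n + b * m ∧
    (MetricGraph.bipartiteDivisor m n a b).HasRank ((a + 1) * (b + 1) - 1) := by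
  lift a to ℕ using ha₀
  lift b to ℕ using hb₀
  exact ⟨MetricGraph.deg_bipartiteDivisor m n a b,
    MetricGraph.hasRank_bipartiteDivisor (by omega) (by omega)⟩
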